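/- Let $\Lambda_{i,j}$ ($i,j\ge 1$) be a nonnegative symmetric coagulation kernel, $0\le \Lambda_{i,j}=\Lambda_{j,i}$, of the form $$\Lambda_{i,j}=\theta_i\theta_j+\kappa_{i,j},\qquad i,j\ge 1,$$ with nonnegative real numbers $\theta_i$ and $\kappa_{i,j}$, and assume that at least one of the following two conditions holds: (a) $\displaystyle\lim_{i\to\infty}\frac{\theta_i}{i}=0$ and, for each $i\ge 1$, $\displaystyle\lim_{j\to\infty}\frac{\kappa_{i,j}}{j}=0$; (b) $\displaystyle\inf_{i\ge 1}\frac{\theta_i}{i}=B>0$ and there is a constant $A\ge 0$ with $\kappa_{i,j}\le A\,\theta_i\theta_j$ for all $i,j\ge 1$. For a real sequence $y=(y_i)_{i\ge 1}$ put $\|y\|_1=\sum_{i=1}^\infty i\,|y_i|$, and let $Y_1^+$ be the set of sequences with $\|y\|_1<\infty$ and $y_i\ge 0$ for all $i\ge 1$. Then for every $\omega^{in}=(\omega_i^{in})_{i\ge 1}\in Y_1^+$ the discrete Safronov–Dubovskiĭ coagulation equations with initial datum $\omega^{in}$ have at least one solution on $[0,\infty)$, that is, there is a sequence $\omega=(\omega_i)_{i\ge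 1}$ of nonnegative continuous functions on $[0,\infty)$ such that for every $i\ge 1$ and $t>0$ one has $\sum_{j=1}^\infty\Lambda_{i,j}\omega_j\in L^1(0,t)$ and $$\omega_i(t)=\omega_i^{in}+\int_0^t\Big(\omega_{i-1}(s)\sum_{j=1}^{i-1}j\Lambda_{i-1,j}\omega_j(s)-\omega_i(s)\sum_{j=1}^{i}j\Lambda_{i,j}\omega_j(s)-\sum_{j=i}^{\infty}\Lambda_{i,j}\omega_i(s)\omega_j(s)\Big)\,ds,$$ where for $i=1$ the first term is $0$. Moreover, this solution can be chosen such that $\omega(t)\in Y_1^+$ and $$\|\omega(t)\|_1\le\|\omega^{in}\|_1\qquad\text{for all } t\in[0,\infty).$$ -/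

import Mathlib

open MeasureTheory Filter Topology

namespace SafronovDubovskii

/-- The norm `‖y‖_p = ∑_{i ≥ 1} i ^ p * |y_i|` (meaningful for `y ∈ Y p`). -/
noncomputable def norm (p : ℝ) (y : ℕ+ → ℝ) : ℝ :=
  ∑' i : ℕ+, (i : ℝ) ^ p * |y i|

/-- The space `Y_p` of sequences `(y_i)_{i ≥ 1}` with `∑_{i ≥ 1} i ^ p * |y_i| < ∞`. -/
def Y (p : ℝ) : Set (ℕ+ → ℝ) :=
  {y | Summable fun i : ℕ+ => (i : ℝ) ^ p * |y i|}

/-- The nonnegative cone `Y_p^+` of `Y_p`. -/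
def YPlus (p : ℝ) : Set (ℕ+ → ℝ) :=
  {y | y ∈ Y p ∧ ∀ i, 0 ≤ y i}

/-- A coagulation kernel is nonnegative and symmetric. -/
structure IsCoagulationKernel (Λ : ℕ+ → ℕ+ → ℝ) : Prop where
  nonneg : ∀ i j, 0 ≤ Λ i j
  symm : ∀ i j, Λ i j = Λ j i

/-- `Λ_{i,j} = θ_i θ_j + κ_{i,j}` with nonnegative `θ` and `κ`. -/
structure HasDecomposition (Λ : ℕ+ → ℕ+ → ℝ) (θ : ℕ+ → ℝ) (κ : ℕ+ → ℕ+ → ℝ) : Prop where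
  theta_nonneg : ∀ i, 0 ≤ θ i
  kappa_nonneg : ∀ i j, 0 ≤ κ i j
  eq : ∀ i j, Λ i j = θ i * θ j + κ i j

/-- `θ_i / i → 0` as `i → ∞` and, for each `i`, `κ_{i,j} / j → 0` as `j → ∞`. -/
def SublinearRates (θ : ℕ+ → ℝ) (κ : ℕ+ → ℕ+ → ℝ) : Prop :=
  Tendsto (fun i : ℕ+ => θ i / (i : ℝ)) atTop (𝓝 0) ∧
    ∀ i : ℕ+, Tendsto (fun j : ℕ+ => κ i j / (j : ℝ)) atTop (𝓝 0)

/-- `inf_i θ_i / i = B > 0` and `κ_{i,j} ≤ A θ_i θ_j` for some `A ≥ 0`. -/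
def AtLeastLinearRates (θ : ℕ+ → ℝ) (κ : ℕ+ → ℕ+ → ℝ) : Prop :=
  (∃ B : ℝ, 0 < B ∧ IsGLB (Set.range fun i : ℕ+ => θ i / (i : ℝ)) B) ∧
    ∃ A : ℝ, 0 ≤ A ∧ ∀ i j, κ i j ≤ A * θ i * θ j

/-- The right-hand side of the `i`-th discrete Safronov-Dubovskii equation at the state `w`:
`w_{i-1} ∑_{j=1}^{i-1} j Λ_{i-1,j} w_j - w_i ∑_{j=1}^{i} j Λ_{i,j} w_j - ∑_{j≥i} Λ_{i,j} w_i w_j`.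
For `i = 1` the first sum is empty (the value `1 - 1 = 1` in `ℕ+` plays no role), so the first
term is zero. -/
noncomputable def rhs (Λ : ℕ+ → ℕ+ → ℝ) (w : ℕ+ → ℝ) (i : ℕ+) : ℝ :=
  w (i - 1) * ∑ j ∈ Finset.Ico 1 i, (j : ℝ) * Λ (i - 1) j * w j
    - w i * ∑ j ∈ Finset.Icc 1 i, (j : ℝ) * Λ i j * w j
    - ∑' j : Set.Ici i, Λ i j * w i * w j

/-- `ω` is a solution on `[0, T)`, `T ∈ (0, ∞]`, with initial datum `ωin`, in the integral sense.
Membership of `∑_j Λ_{i,j} ω_j` in `L¹(0,t)` is the convergence of the series at almost every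
`s ∈ (0,t)` together with the integrability of its sum. As every `ω_i` is continuous and
nonnegative, this makes the integrand in `integral_eq` integrable on `(0,t)`. -/
structure IsSolution (Λ : ℕ+ → ℕ+ → ℝ) (ωin : ℕ+ → ℝ) (T : EReal) (ω : ℕ+ → ℝ → ℝ) : Prop where
  nonneg : ∀ i, ∀ t : ℝ, 0 ≤ t → (t : EReal) < T → 0 ≤ ω i t
  continuousOn : ∀ i, ContinuousOn (ω i) {t : ℝ | 0 ≤ t ∧ (t : EReal) < T}
  summable_ae : ∀ i, ∀ t : ℝ, 0 < t → (t : EReal) < T →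
    ∀ᵐ s ∂(volume.restrict (Set.Ioo 0 t)), Summable fun j : ℕ+ => Λ i j * ω j s
  integrable : ∀ i, ∀ t : ℝ, 0 < t → (t : EReal) < T →
    IntegrableOn (fun s => ∑' j : ℕ+, Λ i j * ω j s) (Set.Ioo 0 t)
  integral_eq : ∀ i, ∀ t : ℝ, 0 < t → (t : EReal) < T →
    ω i t = ωin i + ∫ s in (0 : ℝ)..t, rhs Λ (fun j => ω j s) i

end SafronovDubovskii

/-! The system is truncated to sizes at most `n`; bounds uniform in `n` allow a passage to the
limit. Under a weight `g`, each pair `j ≤ i` evolves with coefficient `(g (i + 1) - g i) * j - g j`,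
up to a boundary flux out of size `n` (`sum_mul_truncRhs`). For `g i = i` it vanishes, so mass can
only be lost through the boundary, and every coordinate stays below `M = ‖ωin‖₁`.

The danger is the infinite loss series: its tails must be small in `L¹(0, T)` uniformly in `n`
(`HasUniformTails`). In case (a), `Λ i j / j → 0` makes the tail a small multiple of the mass. In
case (b), the weight `min i N` has nonpositive coefficients, equal to `-N` for `N ≤ j ≤ i`.
Integrating in time and using `θ i * θ j ≤ Λ i j` bounds `∫ (∑_{j ≥ N} θ j * u j) ^ 2` by `2 * M /
N`, and `Λ i j ≤ (1 + A) * θ i * θ j` transfers this to the tails.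

Uniform tails also give equicontinuity in time (`exists_abs_sub_le`). Pointwise limits along a free
ultrafilter exist by compactness of `[0, M]`; equicontinuity makes the convergence locally uniform,
and the tails let the loss series pass to the limit (`isSolution_of_tendsto`). -/

namespace SafronovDubovskii

/-! ### The truncated system and its moments -/

/-- The flux `w_i ∑_{j ≤ i} j Λ_{i,j} w_j` from clusters of size `i` to clusters of size `i + 1`. -/
noncomputable def flux (Λ : ℕ+ → ℕ+ → ℝ) (w : ℕ+ → ℝ) (i : ℕ+) : ℝ :=
  w i * ∑ j ∈ Finset.Icc 1 i, (j : ℝ) * Λ i j * w j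

/-- The flux into clusters of size `i` from clusters of size `i - 1`. -/
noncomputable def inflow (Λ : ℕ+ → ℕ+ → ℝ) (w : ℕ+ → ℝ) (i : ℕ+) : ℝ :=
  w (i - 1) * ∑ j ∈ Finset.Ico 1 i, (j : ℝ) * Λ (i - 1) j * w j

/-- The right-hand side of the equations truncated at size `n`. -/
noncomputable def truncRhs (Λ : ℕ+ → ℕ+ → ℝ) (n : ℕ+) (w : ℕ+ → ℝ) (i : ℕ+) : ℝ :=
  inflow Λ w i - flux Λ w i - w i * ∑ j ∈ Finset.Icc i n, Λ i j * w j

theorem inflow_one (Λ : ℕ+ → ℕ+ → ℝ) (w : ℕ+ → ℝ) : inflow Λ w 1 = 0 := by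
  simp [inflow]

theorem inflow_add_one (Λ : ℕ+ → ℕ+ → ℝ) (w : ℕ+ → ℝ) (i : ℕ+) :
    inflow Λ w (i + 1) = flux Λ w i := by
  have h : Finset.Ico 1 (i + 1) = Finset.Icc 1 i := by
    ext j; simp
  simp [inflow, flux, h, PNat.add_sub]

theorem flux_nonneg {Λ : ℕ+ → ℕ+ → ℝ} (hΛ : ∀ i j, 0 ≤ Λ i j) {w : ℕ+ → ℝ} (hw : ∀ i, 0 ≤ w i)
    (i : ℕ+) : 0 ≤ flux Λ w i :=
  mul_nonneg (hw i) (Finset.sum_nonneg fun j _ => mul_nonneg (mul_nonneg (by positivity) (hΛ _ _))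
    (hw j))

theorem inflow_nonneg {Λ : ℕ+ → ℕ+ → ℝ} (hΛ : ∀ i j, 0 ≤ Λ i j) {w : ℕ+ → ℝ} (hw : ∀ i, 0 ≤ w i)
    (i : ℕ+) : 0 ≤ inflow Λ w i :=
  mul_nonneg (hw _) (Finset.sum_nonneg fun j _ => mul_nonneg (mul_nonneg (by positivity) (hΛ _ _))
    (hw j))

theorem Icc_one_add_one (n : ℕ+) : Finset.Icc 1 (n + 1) = insert (n + 1) (Finset.Icc 1 n) := by
  ext j
  simp only [Finset.mem_Icc, one_le, true_and, Finset.mem_insert]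
  rw [le_iff_eq_or_lt, PNat.lt_add_one_iff]

theorem sum_Icc_one_add_one (f : ℕ+ → ℝ) (n : ℕ+) :
    ∑ i ∈ Finset.Icc 1 (n + 1), f i = ∑ i ∈ Finset.Icc 1 n, f i + f (n + 1) := by
  rw [Icc_one_add_one, Finset.sum_insert (by simp), add_comm]

/-- Summation by parts: what enters size `i + 1` is exactly what leaves size `i`. -/
theorem sum_mul_inflow_sub_flux (Λ : ℕ+ → ℕ+ → ℝ) (w g : ℕ+ → ℝ) (n : ℕ+) :
    ∑ i ∈ Finset.Icc 1 n, g i * (inflow Λ w i - flux Λ w i) =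
      ∑ i ∈ Finset.Icc 1 n, (g (i + 1) - g i) * flux Λ w i - g (n + 1) * flux Λ w n := by
  induction n using PNat.recOn with
  | one => simp [inflow_one]; ring
  | succ n ih => rw [sum_Icc_one_add_one, ih, sum_Icc_one_add_one, inflow_add_one]; ring

/-- The evolution of the moment with weight `g` under the truncated equations. -/
theorem sum_mul_truncRhs {Λ : ℕ+ → ℕ+ → ℝ} (hsymm : ∀ i j, Λ i j = Λ j i) (w g : ℕ+ → ℝ)
    (n : ℕ+) :
    ∑ i ∈ Finset.Icc 1 n, g i * truncRhs Λ n w i =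
      ∑ i ∈ Finset.Icc 1 n, ∑ j ∈ Finset.Icc 1 i,
        ((g (i + 1) - g i) * j - g j) * (Λ i j * w i * w j) - g (n + 1) * flux Λ w n := by
  -- Symmetry of `Λ` relabels the loss pairs `i ≤ j` as `j ≤ i`, the index set of the flux terms.
  have hloss : ∑ i ∈ Finset.Icc 1 n, g i * (w i * ∑ j ∈ Finset.Icc i n, Λ i j * w j) =
      ∑ i ∈ Finset.Icc 1 n, ∑ j ∈ Finset.Icc 1 i, g j * (Λ i j * w i * w j) := by
    simp only [Finset.mul_sum]
    rw [Finset.sum_comm' (t' := Finset.Icc 1 n) (s' := fun j => Finset.Icc 1 j)]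
    · refine Finset.sum_congr rfl fun i _ => Finset.sum_congr rfl fun j _ => ?_
      rw [hsymm j i]; ring
    · intro i j
      simp only [Finset.mem_Icc, one_le, true_and]
      exact ⟨fun h => h.2, fun h => ⟨h.1.trans h.2, h⟩⟩
  have hflux : ∑ i ∈ Finset.Icc 1 n, (g (i + 1) - g i) * flux Λ w i =
      ∑ i ∈ Finset.Icc 1 n, ∑ j ∈ Finset.Icc 1 i,
        (g (i + 1) - g i) * j * (Λ i j * w i * w j) := by
    refine Finset.sum_congr rfl fun i _ => ?_
    simp only [flux, Finset.mul_sum]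
    exact Finset.sum_congr rfl fun j _ => by ring
  have hsplit : ∑ i ∈ Finset.Icc 1 n, ∑ j ∈ Finset.Icc 1 i,
      ((g (i + 1) - g i) * j - g j) * (Λ i j * w i * w j) =
      ∑ i ∈ Finset.Icc 1 n, (g (i + 1) - g i) * flux Λ w i -
        ∑ i ∈ Finset.Icc 1 n, ∑ j ∈ Finset.Icc 1 i, g j * (Λ i j * w i * w j) := by
    rw [hflux, ← Finset.sum_sub_distrib]
    refine Finset.sum_congr rfl fun i _ => ?_
    rw [← Finset.sum_sub_distrib]
    exact Finset.sum_congr rfl fun j _ => by ring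
  have hlhs : ∑ i ∈ Finset.Icc 1 n, g i * truncRhs Λ n w i =
      ∑ i ∈ Finset.Icc 1 n, g i * (inflow Λ w i - flux Λ w i) -
        ∑ i ∈ Finset.Icc 1 n, g i * (w i * ∑ j ∈ Finset.Icc i n, Λ i j * w j) := by
    rw [← Finset.sum_sub_distrib]
    exact Finset.sum_congr rfl fun i _ => by rw [truncRhs]; ring
  rw [hlhs, hsplit, hloss, sum_mul_inflow_sub_flux]
  ring

/-- The mass does not increase under the truncated equations. -/
theorem sum_id_mul_truncRhs_nonpos {Λ : ℕ+ → ℕ+ → ℝ} (hΛ : IsCoagulationKernel Λ) {w : ℕ+ → ℝ}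
    (hw : ∀ i, 0 ≤ w i) (n : ℕ+) : ∑ i ∈ Finset.Icc 1 n, (i : ℝ) * truncRhs Λ n w i ≤ 0 := by
  rw [sum_mul_truncRhs hΛ.symm w (fun i => (i : ℝ)) n]
  have h := flux_nonneg hΛ.nonneg hw n
  have h0 : ∑ i ∈ Finset.Icc 1 n, ∑ j ∈ Finset.Icc 1 i,
      ((((i + 1 : ℕ+) : ℝ) - i) * j - j) * (Λ i j * w i * w j) = 0 :=
    Finset.sum_eq_zero fun i _ => Finset.sum_eq_zero fun j _ => by push_cast; ring
  rw [h0]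
  have : 0 ≤ (((n + 1 : ℕ+) : ℝ)) * flux Λ w n := by positivity
  linarith

/-- Dissipation of the moment with weight `min i N`. -/
theorem sum_min_mul_truncRhs_le {Λ : ℕ+ → ℕ+ → ℝ} (hΛ : IsCoagulationKernel Λ) {w : ℕ+ → ℝ}
    (hw : ∀ i, 0 ≤ w i) (n N : ℕ+) :
    ∑ i ∈ Finset.Icc 1 n, (min i N : ℝ) * truncRhs Λ n w i ≤
      -((N : ℝ) / 2 * ∑ i ∈ Finset.Icc N n, ∑ j ∈ Finset.Icc N n, Λ i j * w i * w j) := by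
  have hp : ∀ i j, 0 ≤ Λ i j * w i * w j := fun i j =>
    mul_nonneg (mul_nonneg (hΛ.nonneg i j) (hw i)) (hw j)
  rw [sum_mul_truncRhs hΛ.symm w (fun i => (min i N : ℝ)) n]
  have h := flux_nonneg hΛ.nonneg hw n
  -- The square is covered by the triangle `j ≤ i` and its reflection, which have equal sums; hence
  -- the factor `1 / 2`.
  have hsq : ∑ i ∈ Finset.Icc N n, ∑ j ∈ Finset.Icc N n, Λ i j * w i * w j ≤
      2 * ∑ i ∈ Finset.Icc N n, ∑ j ∈ Finset.Icc N i, Λ i j * w i * w j := by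
    have hswap : ∑ i ∈ Finset.Icc N n, ∑ j ∈ Finset.Icc N i, Λ i j * w i * w j =
        ∑ i ∈ Finset.Icc N n, ∑ j ∈ Finset.Icc i n, Λ i j * w i * w j := by
      rw [Finset.sum_comm' (t' := Finset.Icc N n) (s' := fun j => Finset.Icc j n)]
      · refine Finset.sum_congr rfl fun i _ => Finset.sum_congr rfl fun j _ => ?_
        rw [hΛ.symm j i]; ring
      · intro i j
        simp only [Finset.mem_Icc]
        exact ⟨fun h => ⟨⟨h.2.2, h.1.2⟩, h.2.1, h.2.2.trans h.1.2⟩,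
          fun h => ⟨⟨h.2.1.trans h.1.1, h.1.2⟩, h.2.1, h.1.1⟩⟩
    rw [two_mul]
    nth_rewrite 2 [hswap]
    rw [← Finset.sum_add_distrib]
    refine Finset.sum_le_sum fun i hi => ?_
    rw [← Finset.sum_union_inter]
    refine le_add_of_le_of_nonneg ?_ (Finset.sum_nonneg fun j _ => hp i j)
    refine Finset.sum_le_sum_of_subset_of_nonneg ?_ fun j _ _ => hp i j
    intro j hj
    simp only [Finset.mem_Icc, Finset.mem_union] at hi hj ⊢
    rcases le_total j i with h | h
    · exact Or.inl ⟨hj.1, h⟩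
    · exact Or.inr ⟨h, hj.2⟩
  have hmain : ∑ i ∈ Finset.Icc 1 n, ∑ j ∈ Finset.Icc 1 i,
      ((min (((i + 1 : ℕ+) : ℝ)) (N : ℝ) - min (i : ℝ) N) * j - min (j : ℝ) N) *
        (Λ i j * w i * w j) ≤
      -((N : ℝ) * ∑ i ∈ Finset.Icc N n, ∑ j ∈ Finset.Icc N i, Λ i j * w i * w j) := by
    -- For `i < N` the weight is linear up to `i + 1` and the coefficient vanishes; for `i ≥ N` the
    -- weight is constant from `i` on and the coefficient is `-min j N`.
    have hle : ∀ i j : ℕ+, j ≤ i →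
        ((min (((i + 1 : ℕ+) : ℝ)) (N : ℝ) - min (i : ℝ) N) * j - min (j : ℝ) N) *
          (Λ i j * w i * w j) ≤ if N ≤ j then -((N : ℝ) * (Λ i j * w i * w j)) else 0 := by
      intro i j hji
      have hji' : (j : ℝ) ≤ i := by exact_mod_cast hji
      rcases lt_or_ge i N with hiN | hiN
      · have h1 : ((i : ℝ)) + 1 ≤ N := by
          have := PNat.add_one_le_iff.2 hiN
          exact_mod_cast this
        rw [if_neg (not_le.2 (lt_of_le_of_lt hji hiN))]
        push_cast
        rw [min_eq_left h1, min_eq_left (by linarith), min_eq_left (by linarith)]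
        ring_nf; exact le_rfl
      · have h1 : (N : ℝ) ≤ i := by exact_mod_cast hiN
        push_cast
        rw [min_eq_right (by linarith), min_eq_right h1]
        split_ifs with hjN
        · rw [min_eq_right (by exact_mod_cast hjN)]
          ring_nf; exact le_rfl
        · rw [sub_self, zero_mul, zero_sub, neg_mul]
          exact neg_nonpos.2 (mul_nonneg (by positivity) (hp i j))
    rw [Finset.mul_sum, ← Finset.sum_neg_distrib]
    calc _ ≤ ∑ i ∈ Finset.Icc 1 n, ∑ j ∈ Finset.Icc 1 i,
          if N ≤ j then -((N : ℝ) * (Λ i j * w i * w j)) else 0 :=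
          Finset.sum_le_sum fun i _ => Finset.sum_le_sum fun j hj =>
            hle i j (Finset.mem_Icc.1 hj).2
      _ = ∑ i ∈ Finset.Icc 1 n, -((N : ℝ) * ∑ j ∈ Finset.Icc N i, Λ i j * w i * w j) := by
          refine Finset.sum_congr rfl fun i _ => ?_
          rw [← Finset.sum_filter, Finset.mul_sum, ← Finset.sum_neg_distrib]
          refine Finset.sum_congr ?_ fun _ _ => rfl
          ext j; simp [and_comm]
      _ = _ := by
          symm
          refine Finset.sum_subset (Finset.Icc_subset_Icc_left one_le) ?_
          intro i _ hi
          have : Finset.Icc N i = ∅ := by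
            simp only [Finset.mem_Icc, not_and] at *
            rw [Finset.Icc_eq_empty_iff]
            intro h; exact hi h (by tauto)
          simp [this]
  have h2 : 0 ≤ min (((n + 1 : ℕ+) : ℝ)) (N : ℝ) * flux Λ w n := by positivity
  have hN : (0 : ℝ) < N := by exact_mod_cast N.pos
  nlinarith [mul_le_mul_of_nonneg_left hsq hN.le]

/-! ### Global existence for the truncated system -/

/-- Global solutions of the ODE obtained by precomposing a `C¹` field with the projection onto
the cube `[0, M]^ι`. -/
theorem exists_hasDerivWithinAt_clamp {ι : Type*} [Fintype ι] {P : (ι → ℝ) → ι → ℝ}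
    (hP : ContDiff ℝ 1 P) {M T : ℝ} (hM : 0 ≤ M) (hT : 0 ≤ T) (x₀ : ι → ℝ) :
    ∃ w : ℝ → ι → ℝ, w 0 = x₀ ∧ ∀ t ∈ Set.Icc 0 T,
      HasDerivWithinAt w (P fun i => max 0 (min M (w t i))) (Set.Icc 0 T) t := by
  set c : (ι → ℝ) → ι → ℝ := fun x i => max 0 (min M (x i)) with hc
  have hcube : IsCompact (Set.Icc (0 : ι → ℝ) (fun _ => M)) := isCompact_Icc
  have hmem : ∀ x, c x ∈ Set.Icc (0 : ι → ℝ) (fun _ => M) := fun x =>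
    ⟨fun i => le_max_left _ _, fun i => max_le hM (min_le_left _ _)⟩
  obtain ⟨K, hK⟩ := (hP.locallyLipschitz.locallyLipschitzOn (s := Set.Icc (0 : ι → ℝ)
    (fun _ => M))).exists_lipschitzOnWith_of_compact hcube
  obtain ⟨L, hL⟩ := hcube.exists_bound_of_continuousOn hP.continuous.continuousOn
  have hcl : LipschitzWith 1 c := by
    refine LipschitzWith.of_dist_le_mul fun x y => ?_
    rw [NNReal.coe_one, one_mul, dist_pi_le_iff dist_nonneg]
    intro i
    refine le_trans ?_ (dist_le_pi_dist x y i)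
    simp only [hc, Real.dist_eq]
    rw [max_comm, max_comm 0]
    refine (abs_max_sub_max_le_abs _ _ _).trans ?_
    rw [min_comm, min_comm M]
    exact abs_inf_sub_inf_le_abs _ _ _
  have hlip : LipschitzWith K (fun x => P (c x)) := by
    have := hK.comp (hcl.lipschitzOnWith (s := Set.univ)) fun x _ => hmem x
    simpa [Function.comp_def, lipschitzOnWith_univ] using this
  have hL0 : ∀ x, ‖P (c x)‖ ≤ L.toNNReal := fun x =>
    (hL _ (hmem x)).trans (Real.le_coe_toNNReal L)
  -- The clamped field is globally bounded by `L`, so the ball of radius `L * T` is not left before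
  -- time `T` and one application of Picard–Lindelöf reaches `T`.
  have hpl : IsPicardLindelof (fun _ x => P (c x)) (tmin := 0) (tmax := T) ⟨0, le_rfl, hT⟩ x₀
      (L.toNNReal * T.toNNReal) 0 L.toNNReal K := by
    refine IsPicardLindelof.of_time_independent (fun x _ => hL0 x) hlip.lipschitzOnWith ?_
    simp [hT]
  exact hpl.exists_eq_forall_mem_Icc_hasDerivWithinAt₀

theorem hasDerivWithinAt_Ici {f : ℝ → ℝ} {f' T t : ℝ}
    (h : HasDerivWithinAt f f' (Set.Icc 0 T) t) (ht : t ∈ Set.Ico 0 T) :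
    HasDerivWithinAt f f' (Set.Ici t) t :=
  h.mono_of_mem_nhdsWithin (Icc_mem_nhdsGE_of_mem ht)

/-- A function that cannot decrease where it is nonpositive remains nonnegative. -/
theorem nonneg_of_deriv_nonneg_of_nonpos {f f' : ℝ → ℝ} {T : ℝ}
    (hf : ∀ t ∈ Set.Icc 0 T, HasDerivWithinAt f (f' t) (Set.Icc 0 T) t) (h0 : 0 ≤ f 0)
    (hf' : ∀ t ∈ Set.Icc 0 T, f t ≤ 0 → 0 ≤ f' t) : ∀ t ∈ Set.Icc 0 T, 0 ≤ f t := by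
  intro t ht
  by_contra! hneg
  -- The barrier `ε * (1 + s)` for `-f` equals `-f t / 2` at `s = t`, so `-f` would exceed it. At a
  -- contact `f ≤ 0`, so the slope of `-f` is at most `0 < ε`.
  set ε := -f t / (2 * (1 + t)) with hε
  have ht1 : 0 < 1 + t := by linarith [ht.1]
  have hε0 : 0 < ε := by rw [hε]; apply div_pos <;> linarith
  have key := image_le_of_deriv_right_lt_deriv_boundary' (f := fun s => -f s)
    (f' := fun s => -f' s) (a := 0) (b := T) (B := fun s => ε * (1 + s)) (B' := fun _ => ε)
    (fun s hs => (hf s hs).continuousWithinAt.neg)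
    (fun s hs => hasDerivWithinAt_Ici (hf s (Set.Ico_subset_Icc_self hs)).neg hs)
    (by simp; linarith) (by fun_prop)
    (fun s _ => by
      simpa using (((hasDerivAt_id s).const_add 1).const_mul ε).hasDerivWithinAt)
    (fun s hs hse => by
      have : f s ≤ 0 := by
        have : 0 ≤ ε * (1 + s) := mul_nonneg hε0.le (by linarith [hs.1])
        linarith
      have := hf' s (Set.Ico_subset_Icc_self hs) this
      linarith) ht
  have : ε * (1 + t) = -f t / 2 := by rw [hε]; field_simp
  linarith

/-- `u` solves the equations truncated at size `n` on `[0, T]`, and vanishes beyond size `n`. -/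
structure IsTruncatedSolution (Λ : ℕ+ → ℕ+ → ℝ) (ωin : ℕ+ → ℝ) (n : ℕ+) (T : ℝ)
    (u : ℕ+ → ℝ → ℝ) : Prop where
  nonneg : ∀ i, ∀ t ∈ Set.Icc 0 T, 0 ≤ u i t
  eq_zero : ∀ i, n < i → ∀ t, u i t = 0
  initial : ∀ i ≤ n, u i 0 = ωin i
  hasDerivWithinAt : ∀ i ≤ n, ∀ t ∈ Set.Icc 0 T,
    HasDerivWithinAt (u i) (truncRhs Λ n (fun j => u j t) i) (Set.Icc 0 T) t

/-- The solution of the clamped ODE never leaves the cube `[0, M]^S`, where the clamp is the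
identity, so it solves the truncated system itself. -/
theorem exists_isTruncatedSolution {Λ : ℕ+ → ℕ+ → ℝ} (hΛ : IsCoagulationKernel Λ) {ωin : ℕ+ → ℝ}
    (hin : ∀ i, 0 ≤ ωin i) (n : ℕ+) {T : ℝ} (hT : 0 ≤ T) :
    ∃ u, IsTruncatedSolution Λ ωin n T u := by
  set S := Finset.Icc 1 n with hS
  have hSmem : ∀ i, i ∈ S ↔ i ≤ n := by simp [hS]
  set e : (S → ℝ) → ℕ+ → ℝ := fun x i => if h : i ∈ S then x ⟨i, h⟩ else 0 with he
  have he_of : ∀ x (i : S), e x i = x i := fun x i => by simp [he]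
  have hecd : ∀ i, ContDiff ℝ 1 (fun x => e x i) := by
    intro i
    by_cases h : i ∈ S
    · simp only [he, h, dite_true]; fun_prop
    · simp only [he, h, dite_false]; fun_prop
  set P : (S → ℝ) → S → ℝ := fun x i => truncRhs Λ n (e x) i with hP
  have hPcd : ContDiff ℝ 1 P := by
    rw [contDiff_pi]
    intro i
    simp only [hP, truncRhs, inflow, flux]
    fun_prop
  set M := ∑ i ∈ S, (i : ℝ) * ωin i with hM
  have hM0 : 0 ≤ M := Finset.sum_nonneg fun i _ => mul_nonneg (by positivity) (hin i)
  obtain ⟨w, hw0, hw⟩ := exists_hasDerivWithinAt_clamp hPcd hM0 hT (fun i : S => ωin i)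
  set c : ℝ → S → ℝ := fun t i => max 0 (min M (w t i)) with hc
  have hec : ∀ t i, 0 ≤ e (c t) i := by
    intro t i
    by_cases h : i ∈ S
    · simp [he, h, hc]
    · simp [he, h]
  have hwi : ∀ i : S, ∀ t ∈ Set.Icc 0 T,
      HasDerivWithinAt (fun t => w t i) (P (c t) i) (Set.Icc 0 T) t := fun i t ht =>
    hasDerivWithinAt_pi.1 (hw t ht) i
  have hpos : ∀ i : S, ∀ t ∈ Set.Icc 0 T, 0 ≤ w t i := by
    intro i
    -- A coordinate at or below zero is clamped to zero, which removes both of its loss terms and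
    -- leaves the nonnegative inflow.
    refine nonneg_of_deriv_nonneg_of_nonpos (hwi i) (by simp [hw0, hin]) fun t ht hle => ?_
    have hci : e (c t) i = 0 := by
      rw [he_of]
      exact max_eq_left ((min_le_right _ _).trans hle)
    simp only [hP, truncRhs, flux, hci, zero_mul, sub_zero]
    exact inflow_nonneg hΛ.nonneg (hec t) _
  -- Mass dissipation only needs the clamped state to be nonnegative, so this bound is available
  -- before the clamp is known to be inactive.
  have hmass : ∀ t ∈ Set.Icc 0 T, ∑ i : S, (i : ℝ) * w t i ≤ M := by
    refine image_le_of_deriv_right_le_deriv_boundary (f' := fun t => ∑ i : S, (i : ℝ) * P (c t) i)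
      (B' := fun _ => 0) ?_ ?_ ?_ continuousOn_const
      (fun t _ => hasDerivWithinAt_const _ _ _) ?_
    · exact continuousOn_finsetSum _ fun i _ => continuousOn_const.mul
        fun t ht => (hwi i t ht).continuousWithinAt
    · intro t ht
      refine hasDerivWithinAt_Ici ?_ ht
      exact HasDerivWithinAt.fun_sum fun i _ =>
        (hwi i t (Set.Ico_subset_Icc_self ht)).const_mul _
    · rw [hw0, hM, ← Finset.sum_coe_sort S]
    · intro t _
      have := sum_id_mul_truncRhs_nonpos hΛ (hec t) n
      rwa [← hS, ← Finset.sum_coe_sort S] at this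
  have hcw : ∀ t ∈ Set.Icc 0 T, c t = w t := by
    intro t ht
    funext i
    have hle : w t i ≤ M := by
      refine le_trans ?_ (hmass t ht)
      refine le_trans ?_ (Finset.single_le_sum (f := fun i : S => (i : ℝ) * w t i)
        (fun j _ => mul_nonneg (by positivity) (hpos j t ht)) (Finset.mem_univ i))
      have : (1 : ℝ) ≤ ((i : ℕ+) : ℝ) := by exact_mod_cast one_le
      exact le_mul_of_one_le_left (hpos i t ht) this
    simp only [hc]
    rw [min_eq_right hle, max_eq_right (hpos i t ht)]
  refine ⟨fun i t => e (w t) i, ?_, ?_, ?_, ?_⟩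
  · intro i t ht
    by_cases h : i ∈ S
    · simpa [he, h] using hpos ⟨i, h⟩ t ht
    · simp [he, h]
  · intro i hi t
    have h : i ∉ S := by rw [hSmem]; exact not_le.2 hi
    simp [he, h]
  · intro i hi
    simp [he, (hSmem i).2 hi, hw0]
  · intro i hi t ht
    have h := hwi ⟨i, (hSmem i).2 hi⟩ t ht
    rw [hcw t ht] at h
    simpa [he, (hSmem i).2 hi] using h

/-! ### A priori bounds for truncated solutions -/

theorem sum_Icc_le_norm_one {y : ℕ+ → ℝ} (hy : y ∈ YPlus 1) (n : ℕ+) :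
    ∑ i ∈ Finset.Icc 1 n, (i : ℝ) * y i ≤ norm 1 y := by
  have h : Summable fun i : ℕ+ => (i : ℝ) ^ (1 : ℝ) * |y i| := hy.1
  refine le_trans (le_of_eq ?_) (h.sum_le_tsum (Finset.Icc 1 n) fun i _ => by positivity)
  exact Finset.sum_congr rfl fun i _ => by rw [Real.rpow_one, abs_of_nonneg (hy.2 i)]

theorem finset_subset_Icc_one (s : Finset ℕ+) : ∃ K, s ⊆ Finset.Icc 1 K := by
  obtain ⟨K, hK⟩ := s.bddAbove
  exact ⟨K, fun i hi => Finset.mem_Icc.2 ⟨one_le, hK hi⟩⟩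

theorem mem_YPlus_one_and_norm_le {y : ℕ+ → ℝ} {M : ℝ} (hy : ∀ i, 0 ≤ y i)
    (h : ∀ K : ℕ+, ∑ i ∈ Finset.Icc 1 K, (i : ℝ) * y i ≤ M) : y ∈ YPlus 1 ∧ norm 1 y ≤ M := by
  have heq : (fun i : ℕ+ => (i : ℝ) ^ (1 : ℝ) * |y i|) = fun i : ℕ+ => (i : ℝ) * y i :=
    funext fun i => by rw [Real.rpow_one, abs_of_nonneg (hy i)]
  have h0 : ∀ i : ℕ+, 0 ≤ (i : ℝ) * y i := fun i => mul_nonneg (by positivity) (hy i)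
  have hs : ∀ s : Finset ℕ+, ∑ i ∈ s, (i : ℝ) * y i ≤ M := fun s => by
    obtain ⟨K, hK⟩ := finset_subset_Icc_one s
    exact (Finset.sum_le_sum_of_subset_of_nonneg hK fun i _ _ => h0 i).trans (h K)
  have hsum : Summable fun i : ℕ+ => (i : ℝ) * y i := summable_of_sum_le h0 hs
  refine ⟨⟨?_, hy⟩, ?_⟩
  · change Summable _
    rwa [heq]
  · rw [norm, heq]
    exact hsum.tsum_le_of_sum_le hs

theorem flux_mono {Λ : ℕ+ → ℕ+ → ℝ} (hΛ : ∀ i j, 0 ≤ Λ i j) {v w : ℕ+ → ℝ} (hv : ∀ i, 0 ≤ v i)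
    (hvw : ∀ i, v i ≤ w i) (i : ℕ+) : flux Λ v i ≤ flux Λ w i := by
  refine mul_le_mul (hvw i) (Finset.sum_le_sum fun j _ => ?_) (Finset.sum_nonneg fun j _ => ?_)
    ((hv i).trans (hvw i))
  · exact mul_le_mul_of_nonneg_left (hvw j) (mul_nonneg (by positivity) (hΛ _ _))
  · exact mul_nonneg (mul_nonneg (by positivity) (hΛ _ _)) (hv j)

theorem inflow_mono {Λ : ℕ+ → ℕ+ → ℝ} (hΛ : ∀ i j, 0 ≤ Λ i j) {v w : ℕ+ → ℝ} (hv : ∀ i, 0 ≤ v i)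
    (hvw : ∀ i, v i ≤ w i) (i : ℕ+) : inflow Λ v i ≤ inflow Λ w i := by
  refine mul_le_mul (hvw _) (Finset.sum_le_sum fun j _ => ?_) (Finset.sum_nonneg fun j _ => ?_)
    ((hv _).trans (hvw _))
  · exact mul_le_mul_of_nonneg_left (hvw j) (mul_nonneg (by positivity) (hΛ _ _))
  · exact mul_nonneg (mul_nonneg (by positivity) (hΛ _ _)) (hv j)

theorem continuousOn_flux {Λ : ℕ+ → ℕ+ → ℝ} {u : ℕ+ → ℝ → ℝ} {s : Set ℝ}
    (hu : ∀ i, ContinuousOn (u i) s) (i : ℕ+) :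
    ContinuousOn (fun t => flux Λ (fun j => u j t) i) s := by
  unfold flux
  fun_prop

theorem continuousOn_inflow {Λ : ℕ+ → ℕ+ → ℝ} {u : ℕ+ → ℝ → ℝ} {s : Set ℝ}
    (hu : ∀ i, ContinuousOn (u i) s) (i : ℕ+) :
    ContinuousOn (fun t => inflow Λ (fun j => u j t) i) s := by
  unfold inflow
  fun_prop

theorem continuousOn_truncRhs {Λ : ℕ+ → ℕ+ → ℝ} {u : ℕ+ → ℝ → ℝ} {s : Set ℝ}
    (hu : ∀ i, ContinuousOn (u i) s) (n i : ℕ+) :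
    ContinuousOn (fun t => truncRhs Λ n (fun j => u j t) i) s := by
  have h1 := continuousOn_flux (Λ := Λ) hu i
  have h2 := continuousOn_inflow (Λ := Λ) hu i
  unfold truncRhs
  fun_prop

namespace IsTruncatedSolution

variable {Λ : ℕ+ → ℕ+ → ℝ} {ωin : ℕ+ → ℝ} {n : ℕ+} {T : ℝ} {u : ℕ+ → ℝ → ℝ}

theorem mono (h : IsTruncatedSolution Λ ωin n T u) {T' : ℝ} (hT : T' ≤ T) :
    IsTruncatedSolution Λ ωin n T' u where
  nonneg i t ht := h.nonneg i t (Set.Icc_subset_Icc_right hT ht)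
  eq_zero := h.eq_zero
  initial := h.initial
  hasDerivWithinAt i hi t ht :=
    (h.hasDerivWithinAt i hi t (Set.Icc_subset_Icc_right hT ht)).mono
      (Set.Icc_subset_Icc_right hT)

theorem continuousOn (h : IsTruncatedSolution Λ ωin n T u) (i : ℕ+) :
    ContinuousOn (u i) (Set.Icc 0 T) := by
  rcases le_or_gt i n with hi | hi
  · exact fun t ht => (h.hasDerivWithinAt i hi t ht).continuousWithinAt
  · rw [show u i = fun _ => 0 from funext (h.eq_zero i hi)]
    exact continuousOn_const

/-- Integrated form of the evolution of a moment. -/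
theorem sum_mul_sub_eq_integral (h : IsTruncatedSolution Λ ωin n T u) (g : ℕ+ → ℝ) {s t : ℝ}
    (hs : 0 ≤ s) (hst : s ≤ t) (ht : t ≤ T) :
    ∑ i ∈ Finset.Icc 1 n, g i * u i t - ∑ i ∈ Finset.Icc 1 n, g i * u i s =
      ∫ r in s..t, ∑ i ∈ Finset.Icc 1 n, g i * truncRhs Λ n (fun j => u j r) i := by
  have hsub : Set.Icc s t ⊆ Set.Icc 0 T := Set.Icc_subset_Icc hs ht
  symm
  refine intervalIntegral.integral_eq_sub_of_hasDeriv_right_of_le hst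
    (f := fun r => ∑ i ∈ Finset.Icc 1 n, g i * u i r) ?_ ?_ ?_
  · exact continuousOn_finsetSum _ fun i _ => continuousOn_const.mul ((h.continuousOn i).mono hsub)
  · intro r hr
    have hr' : r ∈ Set.Ico 0 T := ⟨hs.trans hr.1.le, hr.2.trans_le ht⟩
    refine HasDerivWithinAt.fun_sum fun i hi => ?_
    exact ((hasDerivWithinAt_Ici (h.hasDerivWithinAt i (Finset.mem_Icc.1 hi).2 r
      (Set.Ico_subset_Icc_self hr')) hr').mono Set.Ioi_subset_Ici_self).const_mul _
  · refine ContinuousOn.intervalIntegrable ?_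
    rw [Set.uIcc_of_le hst]
    exact continuousOn_finsetSum _ fun i _ => continuousOn_const.mul
      (continuousOn_truncRhs (fun j => (h.continuousOn j).mono hsub) n i)

theorem sub_eq_integral (h : IsTruncatedSolution Λ ωin n T u) {i : ℕ+} (hi : i ≤ n) {s t : ℝ}
    (hs : 0 ≤ s) (hst : s ≤ t) (ht : t ≤ T) :
    u i t - u i s = ∫ r in s..t, truncRhs Λ n (fun j => u j r) i := by
  simpa [hi] using h.sum_mul_sub_eq_integral (fun j => if j = i then 1 else 0) hs hst ht

/-- The range `K` is independent of `n`, the form of the mass bound that survives the limit; sizes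
beyond `n` contribute nothing. -/
theorem sum_Icc_mul_le (hΛ : IsCoagulationKernel Λ) (hin : ωin ∈ YPlus 1)
    (h : IsTruncatedSolution Λ ωin n T u) (K : ℕ+) {t : ℝ} (ht : t ∈ Set.Icc 0 T) :
    ∑ i ∈ Finset.Icc 1 K, (i : ℝ) * u i t ≤ norm 1 ωin := by
  have h1 : ∑ i ∈ Finset.Icc 1 n, (i : ℝ) * u i t ≤ norm 1 ωin := by
    have h2 := h.sum_mul_sub_eq_integral (fun i => (i : ℝ)) le_rfl ht.1 ht.2
    have h3 : ∫ r in (0 : ℝ)..t, ∑ i ∈ Finset.Icc 1 n, (i : ℝ) * truncRhs Λ n (fun j => u j r) i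
        ≤ 0 := by
      rw [← neg_nonneg, ← intervalIntegral.integral_neg]
      refine intervalIntegral.integral_nonneg ht.1 fun r hr => neg_nonneg.2 ?_
      exact sum_id_mul_truncRhs_nonpos hΛ (fun i => h.nonneg i r ⟨hr.1, hr.2.trans ht.2⟩) n
    have h4 : ∑ i ∈ Finset.Icc 1 n, (i : ℝ) * u i 0 = ∑ i ∈ Finset.Icc 1 n, (i : ℝ) * ωin i :=
      Finset.sum_congr rfl fun i hi => by rw [h.initial i (Finset.mem_Icc.1 hi).2]
    have h5 := sum_Icc_le_norm_one hin n
    linarith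
  refine le_trans ?_ h1
  rw [← Finset.sum_subset (Finset.inter_subset_left (s₁ := Finset.Icc 1 K)
    (s₂ := Finset.Icc 1 n))]
  · exact Finset.sum_le_sum_of_subset_of_nonneg Finset.inter_subset_right
      fun i _ _ => mul_nonneg (by positivity) (h.nonneg i t ht)
  · intro i hi hi'
    have : n < i := by
      simp only [Finset.mem_inter, Finset.mem_Icc, one_le, true_and, not_and, not_le] at hi hi'
      exact hi' hi
    rw [h.eq_zero i this, mul_zero]

theorem apply_le (hΛ : IsCoagulationKernel Λ) (hin : ωin ∈ YPlus 1)
    (h : IsTruncatedSolution Λ ωin n T u) (i : ℕ+) {t : ℝ} (ht : t ∈ Set.Icc 0 T) :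
    u i t ≤ norm 1 ωin := by
  have h0 : ∀ j : ℕ+, 0 ≤ (j : ℝ) * u j t := fun j => mul_nonneg (by positivity) (h.nonneg j t ht)
  refine le_trans ?_ (h.sum_Icc_mul_le hΛ hin i ht)
  refine le_trans ?_ (Finset.single_le_sum (f := fun j : ℕ+ => (j : ℝ) * u j t)
    (fun j _ => h0 j) (Finset.mem_Icc.2 ⟨one_le, le_rfl⟩))
  exact le_mul_of_one_le_left (h.nonneg i t ht) (by exact_mod_cast one_le (a := i))

/-- The quadratic dissipation bound for the tail `∑_{j ≥ N} θ_j u_j`. -/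
theorem integral_sq_sum_le (hΛ : IsCoagulationKernel Λ) (hin : ωin ∈ YPlus 1) {θ : ℕ+ → ℝ}
    (hθ : ∀ i, 0 ≤ θ i) (hθΛ : ∀ i j, θ i * θ j ≤ Λ i j) (hT : 0 ≤ T)
    (h : IsTruncatedSolution Λ ωin n T u) (N K : ℕ+) :
    ∫ r in (0 : ℝ)..T, (∑ j ∈ Finset.Icc N K, θ j * u j r) ^ 2 ≤ 2 * norm 1 ωin / N := by
  have hN : (0 : ℝ) < N := by exact_mod_cast N.pos
  have hmom := h.sum_mul_sub_eq_integral (fun i => (min i N : ℝ)) le_rfl hT le_rfl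
  -- The squared tail is at most `2 / N` times the dissipation rate of the `min i N` moment, whose
  -- time integral is at most the initial mass.
  have hint : ∀ r ∈ Set.Icc 0 T, (∑ j ∈ Finset.Icc N K, θ j * u j r) ^ 2 ≤
      2 / N * -∑ i ∈ Finset.Icc 1 n, (min i N : ℝ) * truncRhs Λ n (fun j => u j r) i := by
    intro r hr
    have hnn : ∀ j, 0 ≤ θ j * u j r := fun j => mul_nonneg (hθ j) (h.nonneg j r hr)
    have h1 : ∑ j ∈ Finset.Icc N K, θ j * u j r ≤ ∑ j ∈ Finset.Icc N n, θ j * u j r := by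
      rw [← Finset.sum_subset (Finset.inter_subset_left (s₁ := Finset.Icc N K)
        (s₂ := Finset.Icc N n))]
      · exact Finset.sum_le_sum_of_subset_of_nonneg Finset.inter_subset_right fun i _ _ => hnn i
      · intro i hi hi'
        have : n < i := by
          simp only [Finset.mem_inter, Finset.mem_Icc, not_and, not_le] at hi hi'
          exact hi' hi hi.1
        rw [h.eq_zero i this, mul_zero]
    have h2 := sum_min_mul_truncRhs_le hΛ (fun i => h.nonneg i r hr) n N
    have h3 : (∑ j ∈ Finset.Icc N n, θ j * u j r) ^ 2 ≤
        ∑ i ∈ Finset.Icc N n, ∑ j ∈ Finset.Icc N n, Λ i j * u i r * u j r := by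
      rw [sq, Finset.sum_mul_sum]
      refine Finset.sum_le_sum fun i _ => Finset.sum_le_sum fun j _ => ?_
      calc θ i * u i r * (θ j * u j r) = θ i * θ j * (u i r * u j r) := by ring
        _ ≤ Λ i j * (u i r * u j r) := mul_le_mul_of_nonneg_right (hθΛ i j)
            (mul_nonneg (h.nonneg i r hr) (h.nonneg j r hr))
        _ = _ := by ring
    calc (∑ j ∈ Finset.Icc N K, θ j * u j r) ^ 2 ≤ (∑ j ∈ Finset.Icc N n, θ j * u j r) ^ 2 :=
          pow_le_pow_left₀ (Finset.sum_nonneg fun j _ => hnn j) h1 2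
      _ ≤ _ := h3
      _ = 2 / N * ((N : ℝ) / 2 *
          ∑ i ∈ Finset.Icc N n, ∑ j ∈ Finset.Icc N n, Λ i j * u i r * u j r) := by field_simp
      _ ≤ _ := mul_le_mul_of_nonneg_left (by linarith) (by positivity)
  have hfin : ∫ r in (0 : ℝ)..T, (∑ j ∈ Finset.Icc N K, θ j * u j r) ^ 2 ≤
      ∫ r in (0 : ℝ)..T,
        2 / N * -∑ i ∈ Finset.Icc 1 n, (min i N : ℝ) * truncRhs Λ n (fun j => u j r) i := by
    refine intervalIntegral.integral_mono_on hT ?_ ?_ hint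
    all_goals
      refine ContinuousOn.intervalIntegrable ?_
      rw [Set.uIcc_of_le hT]
    · exact (continuousOn_finsetSum _ fun i _ => continuousOn_const.mul (h.continuousOn i)).pow 2
    · exact continuousOn_const.mul (continuousOn_finsetSum _ fun i _ => continuousOn_const.mul
        (continuousOn_truncRhs h.continuousOn n i)).neg
  refine hfin.trans ?_
  rw [intervalIntegral.integral_const_mul, intervalIntegral.integral_neg, ← hmom]
  have h5 : ∑ i ∈ Finset.Icc 1 n, (min i N : ℝ) * u i 0 ≤ norm 1 ωin := by
    refine le_trans (Finset.sum_le_sum fun i hi => ?_) (sum_Icc_le_norm_one hin n)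
    rw [h.initial i (Finset.mem_Icc.1 hi).2]
    exact mul_le_mul_of_nonneg_right (min_le_left _ _) (hin.2 i)
  have h6 : 0 ≤ ∑ i ∈ Finset.Icc 1 n, (min i N : ℝ) * u i T :=
    Finset.sum_nonneg fun i _ => mul_nonneg (by positivity) (h.nonneg i T ⟨hT, le_rfl⟩)
  calc _ ≤ 2 / N * norm 1 ωin := mul_le_mul_of_nonneg_left (by linarith) (by positivity)
    _ = _ := by ring

end IsTruncatedSolution

/-! ### Uniform tails and equicontinuity in time -/

/-- The tails `∑_{j ≥ N} Λ_{i,j} u_j` are small in `L¹(0, T)`, uniformly over all truncated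
solutions. -/
def HasUniformTails (Λ : ℕ+ → ℕ+ → ℝ) (ωin : ℕ+ → ℝ) : Prop :=
  ∀ i, ∀ T : ℝ, 0 ≤ T → ∀ ε : ℝ, 0 < ε → ∃ N : ℕ+, ∀ n u, IsTruncatedSolution Λ ωin n T u →
    ∀ K, ∫ r in (0 : ℝ)..T, ∑ j ∈ Finset.Icc N K, Λ i j * u j r ≤ ε

theorem norm_one_nonneg (y : ℕ+ → ℝ) : 0 ≤ norm 1 y :=
  tsum_nonneg fun i => by positivity

/-- Beyond a suitable `N` one has `Λ i j ≤ δ * j`, so the tail is at most `δ` times the mass at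
every time. -/
theorem hasUniformTails_of_sublinear {Λ : ℕ+ → ℕ+ → ℝ} (hΛ : IsCoagulationKernel Λ)
    {ωin : ℕ+ → ℝ} (hin : ωin ∈ YPlus 1)
    (hlim : ∀ i, Tendsto (fun j : ℕ+ => Λ i j / (j : ℝ)) atTop (𝓝 0)) :
    HasUniformTails Λ ωin := by
  intro i T hT ε hε
  set M := norm 1 ωin with hM
  have hM0 : 0 ≤ M := norm_one_nonneg ωin
  set δ := ε / ((M + 1) * (T + 1)) with hδ
  have hδ0 : 0 < δ := by positivity
  obtain ⟨N, hN⟩ := ((hlim i).eventually (gt_mem_nhds hδ0)).exists_forall_of_atTop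
  refine ⟨N, fun n u h K => ?_⟩
  have hb : ∀ r ∈ Set.Icc 0 T, ∑ j ∈ Finset.Icc N K, Λ i j * u j r ≤ δ * M := by
    intro r hr
    calc ∑ j ∈ Finset.Icc N K, Λ i j * u j r ≤ ∑ j ∈ Finset.Icc N K, δ * ((j : ℝ) * u j r) := by
          refine Finset.sum_le_sum fun j hj => ?_
          have hj0 : (0 : ℝ) < j := by exact_mod_cast j.pos
          have := (div_lt_iff₀ hj0).1 (hN j (Finset.mem_Icc.1 hj).1)
          rw [← mul_assoc]
          exact mul_le_mul_of_nonneg_right this.le (h.nonneg j r hr)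
      _ ≤ ∑ j ∈ Finset.Icc 1 K, δ * ((j : ℝ) * u j r) :=
          Finset.sum_le_sum_of_subset_of_nonneg (Finset.Icc_subset_Icc_left one_le) fun j _ _ =>
            mul_nonneg hδ0.le (mul_nonneg (by positivity) (h.nonneg j r hr))
      _ ≤ δ * M := by
          rw [← Finset.mul_sum]
          exact mul_le_mul_of_nonneg_left (h.sum_Icc_mul_le hΛ hin K hr) hδ0.le
  have h1 : ∫ r in (0 : ℝ)..T, ∑ j ∈ Finset.Icc N K, Λ i j * u j r ≤
      ∫ _ in (0 : ℝ)..T, δ * M := by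
    refine intervalIntegral.integral_mono_on hT ?_ (by simp) hb
    refine ContinuousOn.intervalIntegrable ?_
    rw [Set.uIcc_of_le hT]
    exact continuousOn_finsetSum _ fun j _ => continuousOn_const.mul (h.continuousOn j)
  refine h1.trans ?_
  rw [intervalIntegral.integral_const, smul_eq_mul, sub_zero]
  calc T * (δ * M) ≤ (T + 1) * (δ * (M + 1)) := by gcongr <;> linarith
    _ = ε := by rw [hδ]; field_simp

/-- Dissipation controls the tail in `L²`; the inequality `x ≤ δ + x ^ 2 / δ` turns this into an
`L¹` bound. -/
theorem hasUniformTails_of_le_mul {Λ : ℕ+ → ℕ+ → ℝ} (hΛ : IsCoagulationKernel Λ)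
    {ωin : ℕ+ → ℝ} (hin : ωin ∈ YPlus 1) {θ : ℕ+ → ℝ} (hθ : ∀ i, 0 ≤ θ i)
    (hθΛ : ∀ i j, θ i * θ j ≤ Λ i j) {C : ℝ} (hC : 0 ≤ C) (hΛC : ∀ i j, Λ i j ≤ C * θ i * θ j) :
    HasUniformTails Λ ωin := by
  intro i T hT ε hε
  set M := norm 1 ωin with hM
  have hM0 : 0 ≤ M := norm_one_nonneg ωin
  have hθi := hθ i
  set D := C * θ i with hD
  have hD0 : 0 ≤ D := mul_nonneg hC hθi
  -- Both terms of `δ + x ^ 2 / δ`, integrated and multiplied by `D`, are to be at most `ε / 2`; for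
  -- the second, `N` is taken with `2 * M / N ≤ δ ^ 2 * (T + 1)`.
  set δ := ε / (2 * (D + 1) * (T + 1)) with hδ
  have hδ0 : 0 < δ := by positivity
  obtain ⟨m, hm⟩ := exists_nat_gt (2 * M / (δ ^ 2 * (T + 1)))
  set N : ℕ+ := m.succPNat with hNm
  have hN0 : (0 : ℝ) < N := by exact_mod_cast N.pos
  have hNM : 2 * M / N ≤ δ ^ 2 * (T + 1) := by
    have hle : 2 * M / (δ ^ 2 * (T + 1)) ≤ N := by
      refine hm.le.trans ?_
      rw [hNm, Nat.succPNat_coe]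
      exact_mod_cast Nat.le_succ m
    rw [div_le_iff₀ (by positivity)] at hle ⊢
    linarith
  refine ⟨N, fun n u h K => ?_⟩
  have hc : ContinuousOn (fun r => ∑ j ∈ Finset.Icc N K, θ j * u j r) (Set.Icc 0 T) :=
    continuousOn_finsetSum _ fun j _ => continuousOn_const.mul (h.continuousOn j)
  have hb : ∀ r ∈ Set.Icc 0 T, ∑ j ∈ Finset.Icc N K, Λ i j * u j r ≤
      D * (δ + 1 / δ * (∑ j ∈ Finset.Icc N K, θ j * u j r) ^ 2) := by
    intro r hr
    have h1 : ∑ j ∈ Finset.Icc N K, Λ i j * u j r ≤ D * ∑ j ∈ Finset.Icc N K, θ j * u j r := by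
      rw [Finset.mul_sum]
      refine Finset.sum_le_sum fun j _ => ?_
      rw [← mul_assoc]
      exact mul_le_mul_of_nonneg_right (hΛC i j) (h.nonneg j r hr)
    refine h1.trans (mul_le_mul_of_nonneg_left ?_ hD0)
    generalize ∑ j ∈ Finset.Icc N K, θ j * u j r = x
    have h2 : δ + 1 / δ * x ^ 2 - x = ((x - δ / 2) ^ 2 + 3 / 4 * δ ^ 2) / δ := by
      field_simp; ring
    have h3 : 0 ≤ ((x - δ / 2) ^ 2 + 3 / 4 * δ ^ 2) / δ := by positivity
    linarith
  have hsq := h.integral_sq_sum_le hΛ hin hθ hθΛ hT N K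
  have hi2 : IntervalIntegrable (fun r => (∑ j ∈ Finset.Icc N K, θ j * u j r) ^ 2) volume 0 T := by
    refine ContinuousOn.intervalIntegrable ?_
    rw [Set.uIcc_of_le hT]
    exact hc.pow 2
  have h1 : ∫ r in (0 : ℝ)..T, ∑ j ∈ Finset.Icc N K, Λ i j * u j r ≤
      ∫ r in (0 : ℝ)..T, D * (δ + 1 / δ * (∑ j ∈ Finset.Icc N K, θ j * u j r) ^ 2) := by
    refine intervalIntegral.integral_mono_on hT ?_ ?_ hb
    · refine ContinuousOn.intervalIntegrable ?_
      rw [Set.uIcc_of_le hT]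
      exact continuousOn_finsetSum _ fun j _ => continuousOn_const.mul (h.continuousOn j)
    · exact ((intervalIntegrable_const).add (hi2.const_mul _)).const_mul _
  refine h1.trans ?_
  rw [intervalIntegral.integral_const_mul, intervalIntegral.integral_add intervalIntegrable_const
    (hi2.const_mul _), intervalIntegral.integral_const, intervalIntegral.integral_const_mul,
    smul_eq_mul, sub_zero]
  calc D * (T * δ + 1 / δ * ∫ r in (0 : ℝ)..T, (∑ j ∈ Finset.Icc N K, θ j * u j r) ^ 2)
      ≤ D * (T * δ + 1 / δ * (δ ^ 2 * (T + 1))) := by gcongr; exact hsq.trans hNM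
    _ ≤ (D + 1) * ((T + 1) * δ + 1 / δ * (δ ^ 2 * (T + 1))) := by gcongr <;> linarith
    _ = ε := by rw [hδ]; field_simp; ring

theorem hasUniformTails {Λ : ℕ+ → ℕ+ → ℝ} {θ : ℕ+ → ℝ} {κ : ℕ+ → ℕ+ → ℝ}
    (hΛ : IsCoagulationKernel Λ) (hdec : HasDecomposition Λ θ κ)
    (hrates : SublinearRates θ κ ∨ AtLeastLinearRates θ κ) {ωin : ℕ+ → ℝ} (hin : ωin ∈ YPlus 1) :
    HasUniformTails Λ ωin := by
  rcases hrates with ⟨hθ, hκ⟩ | ⟨_, A, hA, hκ⟩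
  · refine hasUniformTails_of_sublinear hΛ hin fun i => ?_
    have := (hθ.const_mul (θ i)).add (hκ i)
    simp only [mul_zero, add_zero] at this
    refine this.congr fun j => ?_
    rw [hdec.eq]; ring
  · refine hasUniformTails_of_le_mul hΛ hin hdec.theta_nonneg (C := 1 + A) (fun i j => ?_)
      (by linarith) fun i j => ?_
    · rw [hdec.eq]; linarith [hdec.kappa_nonneg i j]
    · rw [hdec.eq]; linarith [hκ i j]

/-- The loss sum runs up to `n`, so the derivative need not be bounded uniformly in `n`. Its part
beyond a fixed `N` contributes at most `ε` after integration; the rest is bounded by its value at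
the constant state `M`. -/
theorem IsTruncatedSolution.exists_abs_sub_le {Λ : ℕ+ → ℕ+ → ℝ} (hΛ : IsCoagulationKernel Λ)
    {ωin : ℕ+ → ℝ} (hin : ωin ∈ YPlus 1) (htail : HasUniformTails Λ ωin) (i : ℕ+) {T : ℝ}
    (hT : 0 ≤ T) {ε : ℝ} (hε : 0 < ε) :
    ∃ C : ℝ, 0 ≤ C ∧ ∀ n u, i ≤ n → IsTruncatedSolution Λ ωin n T u →
      ∀ s t, 0 ≤ s → s ≤ t → t ≤ T → |u i t - u i s| ≤ ε + C * (t - s) := by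
  set M := norm 1 ωin with hM
  have hM0 : 0 ≤ M := norm_one_nonneg ωin
  obtain ⟨N, hN⟩ := htail i T hT (ε / (M + 1)) (by positivity)
  have hc0 : ∀ _ : ℕ+, 0 ≤ M := fun _ => hM0
  have hS0 : 0 ≤ ∑ j ∈ Finset.Icc 1 N, Λ i j * M :=
    Finset.sum_nonneg fun j _ => mul_nonneg (hΛ.nonneg _ _) hM0
  have hI0 := inflow_nonneg hΛ.nonneg hc0 i
  have hF0 := flux_nonneg hΛ.nonneg hc0 i
  set C := inflow Λ (fun _ => M) i + flux Λ (fun _ => M) i + M * ∑ j ∈ Finset.Icc 1 N, Λ i j * M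
    with hC
  have hC0 : 0 ≤ C := by positivity
  refine ⟨C, hC0, fun n u hi h s t hs hst ht => ?_⟩
  have hsub : Set.Icc s t ⊆ Set.Icc 0 T := Set.Icc_subset_Icc hs ht
  set τ : ℝ → ℝ := fun r => ∑ j ∈ Finset.Icc N n, Λ i j * u j r with hτ
  have hτ0 : ∀ r ∈ Set.Icc 0 T, 0 ≤ τ r := fun r hr =>
    Finset.sum_nonneg fun j _ => mul_nonneg (hΛ.nonneg _ _) (h.nonneg j r hr)
  have hτc : ContinuousOn τ (Set.Icc 0 T) :=
    continuousOn_finsetSum _ fun j _ => continuousOn_const.mul (h.continuousOn j)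
  have hb : ∀ r ∈ Set.Icc 0 T, |truncRhs Λ n (fun j => u j r) i| ≤ C + M * τ r := by
    intro r hr
    have hu0 : ∀ j, 0 ≤ u j r := fun j => h.nonneg j r hr
    have huM : ∀ j, u j r ≤ M := fun j => h.apply_le hΛ hin j hr
    have h1 := inflow_nonneg hΛ.nonneg hu0 i
    have h2 := flux_nonneg hΛ.nonneg hu0 i
    have h3 := inflow_mono hΛ.nonneg hu0 huM i
    have h4 := flux_mono hΛ.nonneg hu0 huM i
    have hp : ∀ j, 0 ≤ Λ i j * u j r := fun j => mul_nonneg (hΛ.nonneg i j) (hu0 j)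
    have h5 : 0 ≤ ∑ j ∈ Finset.Icc i n, Λ i j * u j r := Finset.sum_nonneg fun j _ => hp j
    have h6 : ∑ j ∈ Finset.Icc i n, Λ i j * u j r ≤ ∑ j ∈ Finset.Icc 1 N, Λ i j * M + τ r := by
      calc ∑ j ∈ Finset.Icc i n, Λ i j * u j r
          ≤ ∑ j ∈ Finset.Icc 1 N ∪ Finset.Icc N n, Λ i j * u j r := by
            refine Finset.sum_le_sum_of_subset_of_nonneg ?_ fun j _ _ => hp j
            intro j hj
            simp only [Finset.mem_Icc, Finset.mem_union, one_le, true_and] at hj ⊢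
            exact (le_total j N).imp id fun hN => ⟨hN, hj.2⟩
        _ ≤ ∑ j ∈ Finset.Icc 1 N, Λ i j * u j r + τ r := by
            rw [hτ, ← Finset.sum_union_inter]
            exact le_add_of_nonneg_right (Finset.sum_nonneg fun j _ => hp j)
        _ ≤ _ := by
            gcongr with j
            · exact hΛ.nonneg i j
            · exact huM j
    have h7 : u i r * ∑ j ∈ Finset.Icc i n, Λ i j * u j r ≤
        M * (∑ j ∈ Finset.Icc 1 N, Λ i j * M + τ r) :=
      mul_le_mul (huM i) h6 h5 hM0
    have h8 : 0 ≤ u i r * ∑ j ∈ Finset.Icc i n, Λ i j * u j r := mul_nonneg (hu0 i) h5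
    have h9 : 0 ≤ M * τ r := mul_nonneg hM0 (hτ0 r hr)
    rw [abs_le, truncRhs, hC]
    constructor <;> nlinarith
  rw [h.sub_eq_integral hi hs hst ht]
  have hτi : ∀ a b, a ∈ Set.Icc 0 T → b ∈ Set.Icc 0 T → IntervalIntegrable τ volume a b :=
    fun a b ha hb => (hτc.mono (Set.uIcc_subset_Icc ha hb)).intervalIntegrable
  have hsT : s ∈ Set.Icc 0 T := ⟨hs, hst.trans ht⟩
  have htT : t ∈ Set.Icc 0 T := ⟨hs.trans hst, ht⟩
  calc |∫ r in s..t, truncRhs Λ n (fun j => u j r) i|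
      ≤ ∫ r in s..t, |truncRhs Λ n (fun j => u j r) i| :=
        intervalIntegral.abs_integral_le_integral_abs hst
    _ ≤ ∫ r in s..t, (C + M * τ r) := by
        refine intervalIntegral.integral_mono_on hst ?_
          (intervalIntegrable_const.add ((hτi s t hsT htT).const_mul M)) fun r hr => hb r (hsub hr)
        refine ContinuousOn.intervalIntegrable ?_
        rw [Set.uIcc_of_le hst]
        exact ((continuousOn_truncRhs h.continuousOn n i).mono hsub).abs
    _ = C * (t - s) + M * ∫ r in s..t, τ r := by
        rw [intervalIntegral.integral_add intervalIntegrable_const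
          ((hτi s t hsT htT).const_mul M), intervalIntegral.integral_const,
          intervalIntegral.integral_const_mul, smul_eq_mul, mul_comm]
    _ ≤ C * (t - s) + (M + 1) * (ε / (M + 1)) := by
        have h1 : ∫ r in s..t, τ r ≤ ∫ r in (0 : ℝ)..T, τ r := by
          refine intervalIntegral.integral_mono_interval hs hst ht ?_
            (hτi 0 T ⟨le_rfl, hT⟩ ⟨hT, le_rfl⟩)
          refine (ae_restrict_iff' measurableSet_Ioc).2 (Eventually.of_forall fun r hr => ?_)
          exact hτ0 r (Set.Ioc_subset_Icc_self hr)
        have h2 : 0 ≤ ∫ r in s..t, τ r :=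
          intervalIntegral.integral_nonneg hst fun r hr => hτ0 r (hsub hr)
        have h3 := hN n u h n
        gcongr
        · linarith
        · exact h1.trans h3
    _ = ε + C * (t - s) := by field_simp; ring

/-! ### Limits of series and integrals -/

/-- Nonnegative series with uniformly small tails converge to the series of the limits. -/
theorem tendsto_sum_Icc_of_uniform_tails {ι : Type*} {l : Filter ι} [l.NeBot] {a : ι → ℕ+ → ℝ}
    {b : ℕ+ → ℝ} (ha : ∀ᶠ n in l, ∀ j, 0 ≤ a n j)
    (hab : ∀ j, Tendsto (fun n => a n j) l (𝓝 (b j)))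
    (htail : ∀ ε : ℝ, 0 < ε → ∃ N : ℕ+, ∀ᶠ n in l, ∀ K, ∑ j ∈ Finset.Icc N K, a n j ≤ ε) :
    Summable b ∧ ∀ m : ι → ℕ+, Tendsto m l atTop →
      Tendsto (fun n => ∑ j ∈ Finset.Icc 1 (m n), a n j) l (𝓝 (∑' j, b j)) := by
  have hb : ∀ j, 0 ≤ b j := fun j => ge_of_tendsto (hab j) (ha.mono fun n h => h j)
  have hsum : ∀ s : Finset ℕ+, Tendsto (fun n => ∑ j ∈ s, a n j) l (𝓝 (∑ j ∈ s, b j)) :=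
    fun s => tendsto_finsetSum _ fun j _ => hab j
  have hcover : ∀ (N K : ℕ+) (f : ℕ+ → ℝ), (∀ j, 0 ≤ f j) → ∑ j ∈ Finset.Icc 1 K, f j ≤
      ∑ j ∈ Finset.Icc 1 N, f j + ∑ j ∈ Finset.Icc N K, f j := by
    intro N K f hf
    rw [← Finset.sum_union_inter]
    refine le_add_of_le_of_nonneg (Finset.sum_le_sum_of_subset_of_nonneg ?_ fun j _ _ => hf j)
      (Finset.sum_nonneg fun j _ => hf j)
    intro j hj
    simp only [Finset.mem_Icc, Finset.mem_union, one_le, true_and] at hj ⊢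
    exact (le_total j N).imp id fun hN => ⟨hN, hj⟩
  have hbs : ∀ ε : ℝ, 0 < ε → ∃ N : ℕ+, (∀ᶠ n in l, ∀ K, ∑ j ∈ Finset.Icc N K, a n j ≤ ε) ∧
      ∀ s : Finset ℕ+, ∑ j ∈ s, b j ≤ ∑ j ∈ Finset.Icc 1 N, b j + ε := by
    intro ε hε
    obtain ⟨N, hN⟩ := htail ε hε
    refine ⟨N, hN, fun s => ?_⟩
    obtain ⟨K, hK⟩ := finset_subset_Icc_one s
    have h1 := Finset.sum_le_sum_of_subset_of_nonneg hK (f := b) fun j _ _ => hb j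
    have h2 := hcover N K b hb
    have h3 := le_of_tendsto (hsum (Finset.Icc N K)) (hN.mono fun n h => h K)
    linarith
  have hsb : Summable b := by
    obtain ⟨N, _, hN⟩ := hbs 1 one_pos
    exact summable_of_sum_le hb hN
  refine ⟨hsb, fun m hm => ?_⟩
  rw [Metric.tendsto_nhds]
  intro ε hε
  -- Three errors of size `ε / 4`: the finite part up to `N`, the tail of `a n` and the tail of `b`.
  obtain ⟨N, hN, hNb⟩ := hbs (ε / 4) (by positivity)
  have h1 := hsb.sum_le_tsum (Finset.Icc 1 N) fun j _ => hb j
  have h2 := hsb.tsum_le_of_sum_le hNb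
  filter_upwards [hN, ha, hm.eventually_ge_atTop N,
    Metric.tendsto_nhds.1 (hsum (Finset.Icc 1 N)) (ε / 4) (by positivity)] with n h3 h4 h5 h6
  have h7 := hcover N (m n) (a n) h4
  have h8 := h3 (m n)
  have h9 : ∑ j ∈ Finset.Icc 1 N, a n j ≤ ∑ j ∈ Finset.Icc 1 (m n), a n j :=
    Finset.sum_le_sum_of_subset_of_nonneg (Finset.Icc_subset_Icc_right h5) fun j _ _ => h4 j
  rw [Real.dist_eq, abs_lt] at *
  constructor <;> linarith [h6.1, h6.2]

/-- Termwise integration of a series of continuous nonnegative functions. -/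
theorem integral_tsum_of_summable {F : ℕ+ → ℝ → ℝ} {t : ℝ} (ht : 0 ≤ t)
    (hc : ∀ j, ContinuousOn (F j) (Set.Icc 0 t)) (h0 : ∀ j, ∀ s ∈ Set.Icc 0 t, 0 ≤ F j s)
    (hs : Summable fun j => ∫ s in (0 : ℝ)..t, F j s) :
    (∀ᵐ s ∂(volume.restrict (Set.Ioc 0 t)), Summable fun j => F j s) ∧
      IntegrableOn (fun s => ∑' j, F j s) (Set.Ioc 0 t) ∧
      ∫ s in (0 : ℝ)..t, ∑' j, F j s = ∑' j, ∫ s in (0 : ℝ)..t, F j s := by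
  have hmem : ∀ᵐ s ∂(volume.restrict (Set.Ioc 0 t)), ∀ j, 0 ≤ F j s :=
    (ae_restrict_iff' measurableSet_Ioc).2
      (Eventually.of_forall fun s hs j => h0 j s (Set.Ioc_subset_Icc_self hs))
  have hint : ∀ j, IntegrableOn (F j) (Set.Ioc 0 t) := fun j =>
    (hc j).integrableOn_Icc.mono_set Set.Ioc_subset_Icc_self
  have hI : ∀ j, ∫ s in (0 : ℝ)..t, F j s = ∫ s in Set.Ioc 0 t, F j s := fun j =>
    intervalIntegral.integral_of_le ht
  simp only [hI] at hs ⊢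
  have hlin : ∀ j, ∫⁻ s in Set.Ioc 0 t, ENNReal.ofReal (F j s) =
      ENNReal.ofReal (∫ s in Set.Ioc 0 t, F j s) := fun j =>
    (ofReal_integral_eq_lintegral_ofReal (hint j) (hmem.mono fun s h => h j)).symm
  have hI0 : ∀ j, 0 ≤ ∫ s in Set.Ioc 0 t, F j s := fun j =>
    integral_nonneg_of_ae (hmem.mono fun s h => h j)
  have hmeas : ∀ j, AEMeasurable (fun s => ENNReal.ofReal (F j s))
      (volume.restrict (Set.Ioc 0 t)) := fun j => (hint j).aemeasurable.ennreal_ofReal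
  have hfin : ∫⁻ s in Set.Ioc 0 t, ∑' j, ENNReal.ofReal (F j s) ≠ ⊤ := by
    rw [lintegral_tsum hmeas]
    simp only [hlin]
    rw [← ENNReal.ofReal_tsum_of_nonneg hI0 hs]
    exact ENNReal.ofReal_ne_top
  have htsm : AEMeasurable (fun s => ∑' j, ENNReal.ofReal (F j s))
      (volume.restrict (Set.Ioc 0 t)) := AEMeasurable.tsum hmeas
  refine ⟨?_, ?_, ?_⟩
  · filter_upwards [ae_lt_top' htsm hfin, hmem] with s hs1 hs2
    have := ENNReal.summable_toReal hs1.ne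
    exact this.congr fun j => ENNReal.toReal_ofReal (hs2 j)
  · refine (integrable_toReal_of_lintegral_ne_top htsm hfin).congr ?_
    filter_upwards [hmem] with s hs2
    rw [ENNReal.tsum_toReal_eq fun j => ENNReal.ofReal_ne_top]
    exact tsum_congr fun j => ENNReal.toReal_ofReal (hs2 j)
  · rw [intervalIntegral.integral_of_le ht]
    refine (integral_tsum_of_summable_integral_norm hint ?_).symm
    refine hs.congr fun j => integral_congr_ae (hmem.mono fun s h => ?_)
    exact (Real.norm_of_nonneg (h j)).symm

/-- Interval integrals pass to locally uniform limits along arbitrary filters. -/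
theorem tendsto_integral_of_tendstoLocallyUniformlyOn {ι : Type*} {l : Filter ι} [l.NeBot]
    {F : ι → ℝ → ℝ} {f : ℝ → ℝ} {t : ℝ} (ht : 0 ≤ t)
    (hF : ∀ᶠ n in l, ContinuousOn (F n) (Set.Icc 0 t))
    (h : TendstoLocallyUniformlyOn F f l (Set.Icc 0 t)) :
    Tendsto (fun n => ∫ s in (0 : ℝ)..t, F n s) l (𝓝 (∫ s in (0 : ℝ)..t, f s)) := by
  have hf : ContinuousOn f (Set.Icc 0 t) := h.continuousOn hF.frequently
  have hu := (tendstoLocallyUniformlyOn_iff_tendstoUniformlyOn_of_compact isCompact_Icc).1 h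
  rw [Metric.tendsto_nhds]
  intro ε hε
  have hε' : 0 < ε / (t + 1) := by positivity
  filter_upwards [hF, Metric.tendstoUniformlyOn_iff.1 hu _ hε'] with n hn hd
  have hii : ∀ {g : ℝ → ℝ}, ContinuousOn g (Set.Icc 0 t) → IntervalIntegrable g volume 0 t :=
    fun hg => ContinuousOn.intervalIntegrable (by rwa [Set.uIcc_of_le ht])
  rw [Real.dist_eq, ← intervalIntegral.integral_sub (hii hn) (hii hf)]
  have hb := intervalIntegral.norm_integral_le_of_norm_le_const (a := 0) (b := t)
    (f := fun s => F n s - f s) (C := ε / (t + 1)) fun s hs => by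
      rw [Set.uIoc_of_le ht] at hs
      have := hd s (Set.Ioc_subset_Icc_self hs)
      rw [dist_comm, Real.dist_eq] at this
      exact this.le
  rw [Real.norm_eq_abs, sub_zero, abs_of_nonneg ht] at hb
  refine hb.trans_lt ?_
  rw [div_mul_eq_mul_div, div_lt_iff₀ (by positivity)]
  nlinarith

/-! ### Passage to the limit -/

section Limit

variable {Λ : ℕ+ → ℕ+ → ℝ} {ωin : ℕ+ → ℝ} {u : ℕ → ℕ+ → ℝ → ℝ} {l : Filter ℕ} {ω : ℕ+ → ℝ → ℝ}

theorem eventually_isTruncatedSolution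
    (hu : ∀ n : ℕ, IsTruncatedSolution Λ ωin n.succPNat n (u n)) (hl : l ≤ atTop) (T : ℝ) :
    ∀ᶠ n in l, IsTruncatedSolution Λ ωin n.succPNat T (u n) := by
  obtain ⟨m, hm⟩ := exists_nat_ge T
  filter_upwards [hl (eventually_ge_atTop m)] with n hn
  exact (hu n).mono (hm.trans (by exact_mod_cast hn))

theorem tendsto_succPNat_atTop : Tendsto Nat.succPNat atTop atTop :=
  tendsto_atTop_mono' atTop (Eventually.of_forall fun _ => le_rfl)
    (OrderIso.pnatIsoNat.symm.tendsto_atTop)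

/-- Pointwise convergence and equicontinuity up to arbitrarily small errors suffice, as in
Arzelà–Ascoli. Local uniformity replaces dominated convergence, which can fail along an ultrafilter.
-/
theorem tendstoLocallyUniformlyOn_of_tendsto (hΛ : IsCoagulationKernel Λ) (hin : ωin ∈ YPlus 1)
    (htail : HasUniformTails Λ ωin) (hu : ∀ n : ℕ, IsTruncatedSolution Λ ωin n.succPNat n (u n))
    [l.NeBot] (hl : l ≤ atTop)
    (hω : ∀ i t, 0 ≤ t → Tendsto (fun n => u n i t) l (𝓝 (ω i t))) (i : ℕ+) {T : ℝ} (hT : 0 ≤ T) :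
    TendstoLocallyUniformlyOn (fun n => u n i) (ω i) l (Set.Icc 0 T) := by
  rw [Metric.tendstoLocallyUniformlyOn_iff]
  intro ε hε x hx
  obtain ⟨C, hC, hCu⟩ := IsTruncatedSolution.exists_abs_sub_le hΛ hin htail i hT
    (ε := ε / 8) (by positivity)
  have hev : ∀ᶠ n in l, ∀ y ∈ Set.Icc 0 T, |u n i y - u n i x| ≤ ε / 8 + C * |y - x| := by
    filter_upwards [eventually_isTruncatedSolution hu hl T,
      (tendsto_succPNat_atTop.mono_left hl).eventually_ge_atTop i] with n hn hi y hy
    rcases le_total x y with h | h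
    · rw [abs_of_nonneg (sub_nonneg.2 h)]
      exact hCu _ _ hi hn x y hx.1 h hy.2
    · rw [abs_sub_comm, abs_sub_comm y x, abs_of_nonneg (sub_nonneg.2 h)]
      exact hCu _ _ hi hn y x hy.1 h hx.2
  have hωi : ∀ y ∈ Set.Icc 0 T, |ω i y - ω i x| ≤ ε / 8 + C * |y - x| := fun y hy =>
    le_of_tendsto ((hω i y hy.1).sub (hω i x hx.1)).abs (hev.mono fun n h => h y hy)
  refine ⟨Set.Icc 0 T ∩ Metric.ball x (ε / (8 * (C + 1))), ?_, ?_⟩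
  · exact inter_mem_nhdsWithin _ (Metric.ball_mem_nhds _ (by positivity))
  · filter_upwards [hev, Metric.tendsto_nhds.1 (hω i x hx.1) (ε / 8) (by positivity)]
      with n h1 h2 y hy
    have h3 := h1 y hy.1
    have h4 := hωi y hy.1
    have h5 : C * |y - x| ≤ ε / 8 := by
      have h6 : |y - x| < ε / (8 * (C + 1)) := by simpa [Real.dist_eq] using hy.2
      calc C * |y - x| ≤ (C + 1) * (ε / (8 * (C + 1))) := by gcongr; linarith
        _ = ε / 8 := by field_simp
    rw [Real.dist_eq] at h2 ⊢
    rw [abs_le] at h3 h4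
    rw [abs_lt] at h2 ⊢
    constructor <;> linarith [h3.1, h3.2, h4.1, h4.2, h2.1, h2.2]

/-- A limit of truncated solutions of increasing size solves the equations. -/
theorem isSolution_of_tendsto (hΛ : IsCoagulationKernel Λ) (hin : ωin ∈ YPlus 1)
    (htail : HasUniformTails Λ ωin) (hu : ∀ n : ℕ, IsTruncatedSolution Λ ωin n.succPNat n (u n))
    [l.NeBot] (hl : l ≤ atTop)
    (hω : ∀ i t, 0 ≤ t → Tendsto (fun n => u n i t) l (𝓝 (ω i t))) :
    IsSolution Λ ωin ⊤ ω := by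
  have hpn : Tendsto Nat.succPNat l atTop := tendsto_succPNat_atTop.mono_left hl
  have hnn : ∀ i t, 0 ≤ t → 0 ≤ ω i t := fun i t ht =>
    ge_of_tendsto (hω i t ht) ((eventually_isTruncatedSolution hu hl t).mono
      fun n h => h.nonneg i t ⟨ht, le_rfl⟩)
  have hlu : ∀ i, ∀ T : ℝ, 0 ≤ T →
      TendstoLocallyUniformlyOn (fun n => u n i) (ω i) l (Set.Icc 0 T) := fun i T hT =>
    tendstoLocallyUniformlyOn_of_tendsto hΛ hin htail hu hl hω i hT
  have huc : ∀ T : ℝ, ∀ᶠ n in l, ∀ i, ContinuousOn (u n i) (Set.Icc 0 T) := fun T =>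
    (eventually_isTruncatedSolution hu hl T).mono fun n h i => h.continuousOn i
  have hcont : ∀ i, ∀ T : ℝ, 0 ≤ T → ContinuousOn (ω i) (Set.Icc 0 T) := fun i T hT =>
    (hlu i T hT).continuousOn ((huc T).mono fun n h => h i).frequently
  have hint1 : ∀ j, ∀ t : ℝ, 0 ≤ t → Tendsto (fun n => ∫ s in (0 : ℝ)..t, u n j s) l
      (𝓝 (∫ s in (0 : ℝ)..t, ω j s)) := fun j t ht =>
    tendsto_integral_of_tendstoLocallyUniformlyOn ht ((huc t).mono fun n h => h j) (hlu j t ht)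
  have hint2 : ∀ i j, ∀ t : ℝ, 0 ≤ t → Tendsto (fun n => ∫ s in (0 : ℝ)..t, u n i s * u n j s) l
      (𝓝 (∫ s in (0 : ℝ)..t, ω i s * ω j s)) := fun i j t ht =>
    tendsto_integral_of_tendstoLocallyUniformlyOn ht ((huc t).mono fun n h => (h i).mul (h j))
      ((hlu i t ht).fun_mul₀ (hlu j t ht) (hcont i t ht) (hcont j t ht))
  have hii : ∀ {g : ℝ → ℝ} {t : ℝ}, 0 ≤ t → ContinuousOn g (Set.Icc 0 t) →
      IntervalIntegrable g volume 0 t := fun ht hg =>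
    ContinuousOn.intervalIntegrable (by rwa [Set.uIcc_of_le ht])
  have hsumint : ∀ (S : Finset ℕ+) (F : ℕ+ → ℝ → ℝ) (t : ℝ), 0 ≤ t →
      (∀ j, ContinuousOn (F j) (Set.Icc 0 t)) →
      ∫ s in (0 : ℝ)..t, ∑ j ∈ S, F j s = ∑ j ∈ S, ∫ s in (0 : ℝ)..t, F j s :=
    fun S F t ht hF => intervalIntegral.integral_finsetSum fun j _ => hii ht (hF j)
  -- the integrals of `w_i ∑_{j ∈ S} c_j w_j`
  have hfin : ∀ (i : ℕ+) (S : Finset ℕ+) (c : ℕ+ → ℝ) (w : ℕ+ → ℝ → ℝ) (t : ℝ), 0 ≤ t →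
      (∀ j, ContinuousOn (w j) (Set.Icc 0 t)) →
      ∫ s in (0 : ℝ)..t, w i s * ∑ j ∈ S, c j * w j s =
        ∑ j ∈ S, c j * ∫ s in (0 : ℝ)..t, w i s * w j s := by
    intro i S c w t ht hw
    simp only [Finset.mul_sum, mul_left_comm _ (c _) _]
    rw [hsumint S (fun j s => c j * (w i s * w j s)) t ht fun j =>
      continuousOn_const.mul ((hw i).mul (hw j))]
    simp only [intervalIntegral.integral_const_mul]
  have hlim : ∀ (i : ℕ+) (S : Finset ℕ+) (c : ℕ+ → ℝ) (t : ℝ), 0 ≤ t →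
      Tendsto (fun n => ∫ s in (0 : ℝ)..t, u n i s * ∑ j ∈ S, c j * u n j s) l
        (𝓝 (∫ s in (0 : ℝ)..t, ω i s * ∑ j ∈ S, c j * ω j s)) := by
    intro i S c t ht
    rw [hfin i S c ω t ht fun j => hcont j t ht]
    refine (tendsto_finsetSum S fun j _ => (hint2 i j t ht).const_mul (c j)).congr' ?_
    filter_upwards [huc t] with n hn
    exact (hfin i S c (u n) t ht hn).symm
  -- the series `∑_j Λ_{i,j} ω_j`
  have hseries : ∀ i, ∀ t : ℝ, 0 ≤ t →
      Summable fun j => ∫ s in (0 : ℝ)..t, Λ i j * ω j s := by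
    intro i t ht
    refine (tendsto_sum_Icc_of_uniform_tails (l := l)
      (a := fun n j => ∫ s in (0 : ℝ)..t, Λ i j * u n j s) ?_ ?_ ?_).1
    · filter_upwards [eventually_isTruncatedSolution hu hl t] with n hn j
      exact intervalIntegral.integral_nonneg ht fun s hs =>
        mul_nonneg (hΛ.nonneg i j) (hn.nonneg j s hs)
    · intro j
      simp only [intervalIntegral.integral_const_mul]
      exact (hint1 j t ht).const_mul _
    · intro ε hε
      obtain ⟨N, hN⟩ := htail i t ht ε hε
      refine ⟨N, ?_⟩
      filter_upwards [eventually_isTruncatedSolution hu hl t] with n hn K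
      rw [← hsumint _ (fun j s => Λ i j * u n j s) t ht fun j =>
        continuousOn_const.mul (hn.continuousOn j)]
      exact hN _ _ hn K
  -- the loss term
  have hloss : ∀ i, ∀ t : ℝ, 0 ≤ t →
      (Summable fun j => ∫ s in (0 : ℝ)..t, if i ≤ j then Λ i j * (ω i s * ω j s) else 0) ∧
      Tendsto (fun n => ∫ s in (0 : ℝ)..t, u n i s * ∑ j ∈ Finset.Icc i n.succPNat,
        Λ i j * u n j s) l
        (𝓝 (∑' j, ∫ s in (0 : ℝ)..t, if i ≤ j then Λ i j * (ω i s * ω j s) else 0)) := by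
    intro i t ht
    -- With `i ≤ j` as an indicator, the partial sum up to `n.succPNat` is exactly the truncated
    -- loss term.
    have key := tendsto_sum_Icc_of_uniform_tails (l := l)
      (a := fun n j => ∫ s in (0 : ℝ)..t, if i ≤ j then Λ i j * (u n i s * u n j s) else 0)
      (b := fun j => ∫ s in (0 : ℝ)..t, if i ≤ j then Λ i j * (ω i s * ω j s) else 0) ?_ ?_ ?_
    · refine ⟨key.1, (key.2 Nat.succPNat hpn).congr' ?_⟩
      filter_upwards [huc t] with n hn
      rw [hfin i _ _ (u n) t ht hn]
      rw [← Finset.sum_subset (Finset.Icc_subset_Icc_left (one_le : 1 ≤ i))]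
      · refine Finset.sum_congr rfl fun j hj => ?_
        simp [(Finset.mem_Icc.1 hj).1]
      · intro j hj hj'
        have : ¬ i ≤ j := fun h => hj' (Finset.mem_Icc.2 ⟨h, (Finset.mem_Icc.1 hj).2⟩)
        simp [this]
    · filter_upwards [eventually_isTruncatedSolution hu hl t] with n hn j
      refine intervalIntegral.integral_nonneg ht fun s hs => ?_
      split_ifs
      · exact mul_nonneg (hΛ.nonneg i j) (mul_nonneg (hn.nonneg i s hs) (hn.nonneg j s hs))
      · exact le_rfl
    · intro j
      by_cases h : i ≤ j
      · simp only [h, if_true, intervalIntegral.integral_const_mul]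
        exact (hint2 i j t ht).const_mul _
      · simp [h]
    · intro ε hε
      have hM0 := norm_one_nonneg ωin
      set M := norm 1 ωin with hM
      obtain ⟨N, hN⟩ := htail i t ht (ε / (M + 1)) (by positivity)
      refine ⟨N, ?_⟩
      filter_upwards [eventually_isTruncatedSolution hu hl t] with n hn K
      calc ∑ j ∈ Finset.Icc N K,
            ∫ s in (0 : ℝ)..t, (if i ≤ j then Λ i j * (u n i s * u n j s) else 0)
          ≤ ∑ j ∈ Finset.Icc N K, M * ∫ s in (0 : ℝ)..t, Λ i j * u n j s := by
            refine Finset.sum_le_sum fun j _ => ?_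
            rw [← intervalIntegral.integral_const_mul]
            refine intervalIntegral.integral_mono_on ht (hii ht ?_)
              (hii ht (continuousOn_const.mul (continuousOn_const.mul (hn.continuousOn j))))
              fun s hs => ?_
            · by_cases h : i ≤ j
              · simp only [h, if_true]
                exact continuousOn_const.mul ((hn.continuousOn i).mul (hn.continuousOn j))
              · simp only [h, if_false]
                exact continuousOn_const
            · have h1 : 0 ≤ Λ i j * u n j s := mul_nonneg (hΛ.nonneg i j) (hn.nonneg j s hs)
              split_ifs
              · rw [mul_left_comm]
                exact mul_le_mul_of_nonneg_right (hn.apply_le hΛ hin i hs) h1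
              · exact mul_nonneg hM0 h1
        _ = M * ∫ s in (0 : ℝ)..t, ∑ j ∈ Finset.Icc N K, Λ i j * u n j s := by
            rw [← Finset.mul_sum, hsumint _ (fun j s => Λ i j * u n j s) t ht fun j =>
              continuousOn_const.mul (hn.continuousOn j)]
        _ ≤ M * (ε / (M + 1)) := mul_le_mul_of_nonneg_left (hN _ _ hn K) hM0
        _ ≤ (M + 1) * (ε / (M + 1)) := by gcongr; linarith
        _ = ε := by field_simp
  have hser : ∀ i, ∀ t : ℝ, 0 ≤ t → _ := fun i t ht =>
    integral_tsum_of_summable (F := fun j s => Λ i j * ω j s) ht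
      (fun j => continuousOn_const.mul (hcont j t ht))
      (fun j s hs => mul_nonneg (hΛ.nonneg i j) (hnn j s hs.1)) (hseries i t ht)
  refine ⟨fun i t ht _ => hnn i t ht, ?_, ?_, ?_, ?_⟩
  · rintro i t ⟨ht, -⟩
    refine (hcont i (t + 1) (by linarith) t ⟨ht, by linarith⟩).mono_of_mem_nhdsWithin ?_
    filter_upwards [self_mem_nhdsWithin, mem_nhdsWithin_of_mem_nhds (Iio_mem_nhds (lt_add_one t))]
      with s hs1 hs2
    exact ⟨hs1.1, hs2.le⟩
  · intro i t ht _
    exact ae_restrict_of_ae_restrict_of_subset Set.Ioo_subset_Ioc_self (hser i t ht.le).1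
  · intro i t ht _
    exact (hser i t ht.le).2.1.mono_set Set.Ioo_subset_Ioc_self
  · intro i t ht _
    have ht0 := ht.le
    obtain ⟨-, hLi, hLe⟩ := integral_tsum_of_summable
      (F := fun j s => if i ≤ j then Λ i j * (ω i s * ω j s) else 0) ht0
      (fun j => by
        by_cases h : i ≤ j
        · simp only [h, if_true]
          exact continuousOn_const.mul ((hcont i t ht0).mul (hcont j t ht0))
        · simp only [h, if_false]
          exact continuousOn_const)
      (fun j s hs => by
        split_ifs
        · exact mul_nonneg (hΛ.nonneg i j) (mul_nonneg (hnn i s hs.1) (hnn j s hs.1))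
        · exact le_rfl)
      (hloss i t ht0).1
    have hrhs : ∀ s, rhs Λ (fun j => ω j s) i = inflow Λ (fun j => ω j s) i -
        flux Λ (fun j => ω j s) i - ∑' j, if i ≤ j then Λ i j * (ω i s * ω j s) else 0 := by
      intro s
      rw [rhs, inflow, flux, tsum_subtype (Set.Ici i) (fun j => Λ i j * ω i s * ω j s)]
      congr 1
      refine tsum_congr fun j => ?_
      simp only [Set.indicator_apply, Set.mem_Ici, mul_assoc]
    have hinc := hii ht0 (continuousOn_inflow (Λ := Λ) (fun j => hcont j t ht0) i)
    have hflc := hii ht0 (continuousOn_flux (Λ := Λ) (fun j => hcont j t ht0) i)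
    simp only [hrhs]
    rw [intervalIntegral.integral_sub (hinc.sub hflc)
      ((intervalIntegrable_iff_integrableOn_Ioc_of_le ht0).2 hLi),
      intervalIntegral.integral_sub hinc hflc, hLe]
    -- The integral equation of `u n i` supplies a second limit for `u n i t`.
    refine tendsto_nhds_unique (hω i t ht0) ?_
    refine (tendsto_const_nhds.add (((hlim (i - 1) (Finset.Ico 1 i)
      (fun j => (j : ℝ) * Λ (i - 1) j) t ht0).sub (hlim i (Finset.Icc 1 i)
      (fun j => (j : ℝ) * Λ i j) t ht0)).sub (hloss i t ht0).2)).congr' ?_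
    filter_upwards [eventually_isTruncatedSolution hu hl t, hpn.eventually_ge_atTop i]
      with n hn hi
    have h1 := hn.sub_eq_integral hi le_rfl ht0 le_rfl
    rw [hn.initial i hi] at h1
    rw [eq_add_of_sub_eq' h1]
    have h2 := hii ht0 (continuousOn_inflow (Λ := Λ) hn.continuousOn i)
    have h3 := hii ht0 (continuousOn_flux (Λ := Λ) hn.continuousOn i)
    have h4 : IntervalIntegrable (fun s => u n i s * ∑ j ∈ Finset.Icc i n.succPNat,
        Λ i j * u n j s) volume 0 t :=
      hii ht0 ((hn.continuousOn i).mul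
        (continuousOn_finsetSum _ fun j _ => continuousOn_const.mul (hn.continuousOn j)))
    simp only [truncRhs]
    rw [intervalIntegral.integral_sub (h2.sub h3) h4, intervalIntegral.integral_sub h2 h3]
    rfl

end Limit

end SafronovDubovskii

theorem mainTheorem1 (Λ : ℕ+ → ℕ+ → ℝ) (θ : ℕ+ → ℝ) (κ : ℕ+ → ℕ+ → ℝ)
    (hΛ : SafronovDubovskii.IsCoagulationKernel Λ)
    (hdec : SafronovDubovskii.HasDecomposition Λ θ κ)
    (hrates : SafronovDubovskii.SublinearRates θ κ ∨ SafronovDubovskii.AtLeastLinearRates θ κ)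
    (ωin : ℕ+ → ℝ) (hin : ωin ∈ SafronovDubovskii.YPlus 1) :
    ∃ ω : ℕ+ → ℝ → ℝ, SafronovDubovskii.IsSolution Λ ωin ⊤ ω ∧
      ∀ t : ℝ, 0 ≤ t →
        (fun i => ω i t) ∈ SafronovDubovskii.YPlus 1 ∧
        SafronovDubovskii.norm 1 (fun i => ω i t) ≤ SafronovDubovskii.norm 1 ωin := by
  open SafronovDubovskii in
  have htail := hasUniformTails hΛ hdec hrates hin
  choose u hu using fun n : ℕ =>
    exists_isTruncatedSolution hΛ hin.2 n.succPNat (Nat.cast_nonneg (α := ℝ) n)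
  have hl : (hyperfilter ℕ : Filter ℕ) ≤ atTop := Nat.hyperfilter_le_atTop
  -- With `0 ≤ t` inside the existential, `ω` is defined on all of `ℝ`; its value at negative times
  -- is irrelevant.
  have hlim : ∀ i t, ∃ x, 0 ≤ t → Tendsto (fun n => u n i t) (hyperfilter ℕ) (𝓝 x) := by
    intro i t
    by_cases ht : 0 ≤ t
    · obtain ⟨x, -, hx⟩ := (isCompact_Icc (a := (0 : ℝ)) (b := norm 1 ωin)).ultrafilter_le_nhds'
        ((hyperfilter ℕ).map fun n => u n i t) (by
          rw [Ultrafilter.mem_map]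
          filter_upwards [eventually_isTruncatedSolution hu hl t] with n hn
          exact ⟨hn.nonneg i t ⟨ht, le_rfl⟩, hn.apply_le hΛ hin i ⟨ht, le_rfl⟩⟩)
      exact ⟨x, fun _ => hx⟩
    · exact ⟨0, fun h => absurd h ht⟩
  choose ω hω using hlim
  have hsol := isSolution_of_tendsto hΛ hin htail hu hl hω
  refine ⟨ω, hsol, fun t ht => ?_⟩
  refine mem_YPlus_one_and_norm_le (fun i => hsol.nonneg i t ht (EReal.coe_lt_top t)) fun K => ?_
  -- Finite partial sums keep their bound in the limit; nothing is claimed about equality of the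
  -- full masses.
  refine le_of_tendsto (tendsto_finsetSum _ fun i _ => (hω i t ht).const_mul (i : ℝ)) ?_
  filter_upwards [eventually_isTruncatedSolution hu hl t] with n hn
  exact hn.sum_Icc_mul_le hΛ hin K ⟨ht, le_rfl⟩
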